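/- A \emph{Kummer structure} is a set $K$ with a map $\kappa$ from the set of unordered pairs of elements of $K$ to itself such that, writing $a\ b\to c\ d$ for $\kappa\{a,b\}=\{c,d\}$: (A1) there is $0\in K$ with $a\ 0\to a\ a$ for all $a$; (A2) for every $a$ there is $2a\in K$ with $a\ a\to 0\ 2a$; (A3) for all $a,b,c$ there are $p_0,p_1,q_0,q_1,s_0,\dots,s_3\in K$ with $a\ b\to p_0\ p_1$, $c\ b\to q_0\ q_1$, $a\ q_0\to s_0\ s_1$, $a\ q_1\to s_2\ s_3$, $c\ p_0\to s_0\ s_2$, $c\ p_1\to s_1\ s_3$; (A4) $a\ b\to c\ d$ implies $2a\ 2b\to 2c\ 2d$. The \emph{Kummer} of an abelian group $G$ is the set of all $\bar x=\{x,-x\}$, $x\in G$, with $\kappa\{\bar x,\bar y\}=\{\overline{x+y},\overline{x-y}\}$. The \emph{twisted Kummer} of $(G,\iota)$, where $G$ is an abelian group with $2G=0$ and $\iota$ is an automorphism of $G$ with $\iota^2=1$, is the set of all $\bar x=\{x,\iota x\}$, $x\in G$, with $\kappa\{\bar x,\bar y\}=\{\overline{x+y},\overline{x+\iota y}\}$.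 Let $K$ be a Kummer structure that is 4-torsion ($2(2a)=0$ for all $a\in K$) but not 2-torsion ($2a\neq0$ for some $a\in K$). Let $K[2]=\{a\in K\mid 2a=0\}$. For $a\in K$ and $x\in K[2]$ there is a unique element $a+x\in K$ with $a\ x\to (a+x)\ (a+x)$; this makes $K[2]$ a vector space over $\mathbb{Z}/2$ which acts on $K$, and the image $2K$ of the map $a\mapsto 2a$ is a subspace of $K[2]$. Rank means dimension over $\mathbb{Z}/2$. Given a choice of representatives $e_x\in K$ $(x\in 2K)$ with $2e_x=x$ and $e_0=0$, for $x,y\in 2K$ let $\epsilon_{x,y}\in K[2]/\langle x,y\rangle$ be the class consisting of the $u\in K[2]$ with $e_{x+y}+u\in\kappa\{e_x,e_y\}$. For a rank-3 subgroup $X\subseteq 2K$ put $\mathrm{ind}_X=0$ if the representatives can be chosen such that $\epsilon_{x,y}=0$ for all $x,y\in X$ that generate a rank-2 subgroup, and $\mathrm{ind}_X=1$ otherwise. Then: (0) $\mathrm{ind}_X$ is the same for all rank-3 subgroups $X\subseteq 2K$; if $\mathrm{rank}\,2K\ge3$, let $\mathrm{ind}_K$ denote this common value. (1) $K$ is isomorphic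 to the Kummer of an abelian group if and only if $\mathrm{rank}\,2K\le2$ or $\mathrm{ind}_K=1$. (2) $K$ is isomorphic to the twisted Kummer of some $(G,\iota)$ if and only if $\mathrm{rank}\,2K\le2$ or $\mathrm{ind}_K=0$. -/

import Mathlib

universe u

/-- A Kummer structure on a set `K`: a map `κ` on unordered pairs of elements of `K` satisfying
four axioms. The element `zero` and the map `dbl` (written `0` and `a ↦ 2a` in mathematical
notation) are uniquely determined by `κ`. -/
class KummerStructure (K : Type u) where
  /-- the structure map on unordered pairs -/
  κ : Sym2 K → Sym2 K
  /-- the element `0` -/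
  zero : K
  /-- the map `a ↦ 2a` -/
  dbl : K → K
  κ_zero : ∀ a, κ s(a, zero) = s(a, a)
  κ_self : ∀ a, κ s(a, a) = s(zero, dbl a)
  κ_assoc : ∀ a b c, ∃ p₀ p₁ q₀ q₁ s₀ s₁ s₂ s₃,
    κ s(a, b) = s(p₀, p₁) ∧ κ s(c, b) = s(q₀, q₁) ∧
    κ s(a, q₀) = s(s₀, s₁) ∧ κ s(a, q₁) = s(s₂, s₃) ∧
    κ s(c, p₀) = s(s₀, s₂) ∧ κ s(c, p₁) = s(s₁, s₃)
  κ_dbl : ∀ a b c d, κ s(a, b) = s(c, d) → κ s(dbl a, dbl b) = s(dbl c, dbl d)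

namespace KummerStructure

/-- An isomorphism of Kummer structures: a bijection commuting with the structure maps. -/
structure Iso (K : Type u) (L : Type u) [KummerStructure K] [KummerStructure L] extends
    K ≃ L where
  map_κ : ∀ p : Sym2 K, Sym2.map toFun (κ p) = κ (Sym2.map toFun p)

/-! ### Quotients of abelian groups by an involution -/

section Quotients

variable {G : Type u} [AddCommGroup G]

/-- `x` and `y` are identified iff they lie in the same set `{x, ι x}`. -/
def orbitSetoid (ι : G ≃+ G) (hι : ∀ x, ι (ι x) = x) : Setoid G where
  r x y := y = x ∨ y = ι x
  iseqv :=
    { refl := fun _ => Or.inl rfl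
      symm := by
        rintro x y (rfl | rfl)
        · exact Or.inl rfl
        · exact Or.inr (hι x).symm
      trans := by
        rintro x y z (rfl | rfl) (rfl | rfl)
        · exact Or.inl rfl
        · exact Or.inr rfl
        · exact Or.inr rfl
        · exact Or.inl (hι x) }

/-- The set of all `{x, ι x}`. -/
def InvQuot (ι : G ≃+ G) (hι : ∀ x, ι (ι x) = x) : Type u := Quotient (orbitSetoid ι hι)

namespace InvQuot

variable (ι : G ≃+ G) (hι : ∀ x, ι (ι x) = x)

/-- The class `{x, ι x}` of `x`. -/
def mk (x : G) : InvQuot ι hι := Quotient.mk (orbitSetoid ι hι) x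

variable {ι hι}

theorem mk_eq_iff {x y : G} : mk ι hι x = mk ι hι y ↔ y = x ∨ y = ι x :=
  Quotient.eq (r := orbitSetoid ι hι)

theorem mk_ι (x : G) : mk ι hι (ι x) = mk ι hι x :=
  mk_eq_iff.2 (Or.inr (hι x).symm)

theorem mk_ι_add (x y : G) : mk ι hι (ι x + y) = mk ι hι (x + ι y) := by
  rw [← mk_ι (hι := hι) (ι x + y), map_add, hι]

variable (ι hι)

/-- `{x, ι x}, {y, ι y} ↦ {x + y, ι (x + y)}, {x + ι y, ι (x + ι y)}`. -/
def kap : Sym2 (InvQuot ι hι) → Sym2 (InvQuot ι hι) :=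
  Sym2.lift ⟨fun p q => Quotient.liftOn₂ p q
      (fun x y => s(mk ι hι (x + y), mk ι hι (x + ι y)))
      (by
        rintro x y x' y' (rfl | rfl) (rfl | rfl)
        · rfl
        · rw [hι, Sym2.eq_swap]
        · rw [mk_ι_add, ← map_add, mk_ι, Sym2.eq_swap]
        · rw [← map_add, mk_ι, mk_ι_add, hι]),
    by
      rintro ⟨x⟩ ⟨y⟩
      change s(mk ι hι (x + y), mk ι hι (x + ι y)) = s(mk ι hι (y + x), mk ι hι (y + ι x))
      rw [add_comm y x, add_comm y (ι x), mk_ι_add]⟩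

theorem kap_mk (x y : G) :
    kap ι hι s(mk ι hι x, mk ι hι y) = s(mk ι hι (x + y), mk ι hι (x + ι y)) := rfl

theorem kap_assoc (a b c : InvQuot ι hι) : ∃ p₀ p₁ q₀ q₁ s₀ s₁ s₂ s₃,
    kap ι hι s(a, b) = s(p₀, p₁) ∧ kap ι hι s(c, b) = s(q₀, q₁) ∧
    kap ι hι s(a, q₀) = s(s₀, s₁) ∧ kap ι hι s(a, q₁) = s(s₂, s₃) ∧
    kap ι hι s(c, p₀) = s(s₀, s₂) ∧ kap ι hι s(c, p₁) = s(s₁, s₃) := by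
  obtain ⟨a⟩ := a
  obtain ⟨b⟩ := b
  obtain ⟨c⟩ := c
  refine ⟨mk ι hι (a + b), mk ι hι (a + ι b), mk ι hι (c + b), mk ι hι (c + ι b),
    mk ι hι (a + (c + b)), mk ι hι (a + ι (c + b)), mk ι hι (a + ι (c + ι b)),
    mk ι hι (a + (c + ι b)), kap_mk .., kap_mk .., kap_mk .., ?_, ?_, ?_⟩
  · exact (kap_mk ..).trans Sym2.eq_swap
  · refine (kap_mk ..).trans ?_
    refine congrArg₂ (fun u v => s(u, v)) ?_ ?_
    · abel_nf
    · rw [← mk_ι (hι := hι) (c + ι (a + b))]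
      simp only [map_add, hι]
      abel_nf
  · refine (kap_mk ..).trans (Sym2.eq_swap.trans ?_)
    refine congrArg₂ (fun u v => s(u, v)) ?_ ?_
    · rw [← mk_ι (hι := hι) (c + ι (a + ι b))]
      simp only [map_add, hι]
      abel_nf
    · abel_nf

/-- The map `{x, ι x} ↦ {f x, ι (f x)}` induced by an endomorphism `f` commuting with `ι`. -/
def map (f : G →+ G) (hf : ∀ x, f (ι x) = ι (f x)) : InvQuot ι hι → InvQuot ι hι :=
  Quotient.lift (fun x => mk ι hι (f x)) (by
    rintro x y (rfl | rfl)
    · rfl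
    · rw [hf, mk_ι])

theorem kap_map (f : G →+ G) (hf : ∀ x, f (ι x) = ι (f x)) (a b c d : InvQuot ι hι)
    (h : kap ι hι s(a, b) = s(c, d)) :
    kap ι hι s(map ι hι f hf a, map ι hι f hf b) = s(map ι hι f hf c, map ι hι f hf d) := by
  obtain ⟨x⟩ := a
  obtain ⟨y⟩ := b
  refine Eq.trans ?_ (congrArg (Sym2.map (map ι hι f hf)) h)
  change s(mk ι hι (f x + f y), mk ι hι (f x + ι (f y))) =
    s(mk ι hι (f (x + y)), mk ι hι (f (x + ι y)))
  rw [map_add, map_add, hf]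

end InvQuot

variable (G) in
/-- The set `{ {x, -x} | x ∈ G }` underlying the Kummer of the abelian group `G`. -/
def Kummer : Type u := InvQuot (AddEquiv.neg G) (fun x => neg_neg x)

/-- The Kummer of the abelian group `G`, with structure map
`{±x}, {±y} ↦ {±(x + y)}, {±(x - y)}`, zero `{0}` and `2 {±x} = {±2x}`. -/
instance instKummer : KummerStructure (Kummer G) where
  κ := InvQuot.kap _ _
  zero := InvQuot.mk _ _ 0
  dbl := InvQuot.map _ _ (AddMonoidHom.id G + AddMonoidHom.id G)
    (fun x => (map_add (AddEquiv.neg G) x x).symm)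
  κ_zero := by
    rintro ⟨x⟩
    refine (InvQuot.kap_mk ..).trans ?_
    rw [map_zero, add_zero]
    rfl
  κ_self := by
    rintro ⟨x⟩
    refine (InvQuot.kap_mk ..).trans (Sym2.eq_swap.trans ?_)
    rw [AddEquiv.neg_apply, add_neg_cancel]
    rfl
  κ_assoc := InvQuot.kap_assoc _ _
  κ_dbl := InvQuot.kap_map _ _ _ _

variable (G) in
/-- A twisted group: a 2-torsion abelian group together with an involution `ι`
(an automorphism with `ι² = 1`). -/
structure TwistedGroup where
  two_torsion : ∀ x : G, x + x = 0
  ι : G ≃+ G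
  ι_ι : ∀ x, ι (ι x) = x

/-- The set `{ {x, ι x} | x ∈ G }` underlying the twisted Kummer of `(G, ι)`. -/
def TwistedKummer (T : TwistedGroup G) : Type u := InvQuot T.ι T.ι_ι

/-- The twisted Kummer of `(G, ι)`, with structure map
`{x, ι x}, {y, ι y} ↦ {x + y, ι (x + y)}, {x + ι y, ι (x + ι y)}`, zero `{0}` and
`2 {x, ι x} = {x + ι x}`. -/
instance instTwistedKummer (T : TwistedGroup G) : KummerStructure (TwistedKummer T) where
  κ := InvQuot.kap _ _
  zero := InvQuot.mk _ _ 0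
  dbl := InvQuot.map _ _ (AddMonoidHom.id G + T.ι.toAddMonoidHom)
    (fun x => (map_add T.ι x (T.ι x)).symm)
  κ_zero := by
    rintro ⟨x⟩
    refine (InvQuot.kap_mk ..).trans ?_
    rw [map_zero, add_zero]
    rfl
  κ_self := by
    rintro ⟨x⟩
    refine (InvQuot.kap_mk ..).trans ?_
    rw [T.two_torsion]
    rfl
  κ_assoc := InvQuot.kap_assoc _ _
  κ_dbl := InvQuot.kap_map _ _ _ _

end Quotients

/-! ### First properties -/

section Basic

variable {K : Type u} [KummerStructure K]

theorem dbl_zero : dbl (zero : K) = zero := by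
  have h := (κ_self (zero : K)).symm.trans (κ_zero zero)
  rw [Sym2.eq_iff] at h
  tauto

theorem mem_κ_rot {a b c : K} (h : c ∈ κ s(a, b)) : a ∈ κ s(b, c) := by
  obtain ⟨p₀, p₁, q₀, q₁, s₀, s₁, s₂, s₃, h1, h2, h3, h4, h5, h6⟩ := κ_assoc a b b
  have hz := κ_zero a
  have hs := κ_self b
  rw [h1, Sym2.mem_iff] at h
  rw [h2, Sym2.eq_iff] at hs
  rcases hs with ⟨rfl, -⟩ | ⟨-, rfl⟩
  · rw [h3, Sym2.eq_iff] at hz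
    rcases h with rfl | rfl
    · rw [h5, Sym2.mem_iff]; tauto
    · rw [h6, Sym2.mem_iff]; tauto
  · rw [h4, Sym2.eq_iff] at hz
    rcases h with rfl | rfl
    · rw [h5, Sym2.mem_iff]; tauto
    · rw [h6, Sym2.mem_iff]; tauto

theorem mem_κ_iff {a b c : K} : c ∈ κ s(a, b) ↔ a ∈ κ s(b, c) :=
  ⟨mem_κ_rot, fun h => mem_κ_rot (mem_κ_rot h)⟩

theorem mem_κ_comm {a b c : K} : c ∈ κ s(a, b) ↔ b ∈ κ s(a, c) := by
  rw [mem_κ_iff, mem_κ_iff, Sym2.eq_swap]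

theorem zero_mem_κ {a b : K} : zero ∈ κ s(a, b) ↔ a = b := by
  rw [mem_κ_iff, κ_zero, Sym2.mem_iff, or_self]

/-- The associativity diagram with a prescribed ordering of two of the pairs. -/
theorem κ_assoc' {a b c p₀ p₁ q₀ q₁ : K} (hp : κ s(a, b) = s(p₀, p₁))
    (hq : κ s(c, b) = s(q₀, q₁)) : ∃ s₀ s₁ s₂ s₃,
    κ s(a, q₀) = s(s₀, s₁) ∧ κ s(a, q₁) = s(s₂, s₃) ∧
    κ s(c, p₀) = s(s₀, s₂) ∧ κ s(c, p₁) = s(s₁, s₃) := by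
  obtain ⟨p₀', p₁', q₀', q₁', s₀, s₁, s₂, s₃, h1, h2, h3, h4, h5, h6⟩ := κ_assoc a b c
  rw [hp, Sym2.eq_iff] at h1
  rw [hq, Sym2.eq_iff] at h2
  rcases h1 with ⟨rfl, rfl⟩ | ⟨rfl, rfl⟩ <;> rcases h2 with ⟨rfl, rfl⟩ | ⟨rfl, rfl⟩
  · exact ⟨s₀, s₁, s₂, s₃, h3, h4, h5, h6⟩
  · exact ⟨s₂, s₃, s₀, s₁, h4, h3, h5.trans Sym2.eq_swap, h6.trans Sym2.eq_swap⟩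
  · exact ⟨s₁, s₀, s₃, s₂, h3.trans Sym2.eq_swap, h4.trans Sym2.eq_swap, h6, h5⟩
  · exact ⟨s₃, s₂, s₁, s₀, h4.trans Sym2.eq_swap, h3.trans Sym2.eq_swap,
      h6.trans Sym2.eq_swap, h5.trans Sym2.eq_swap⟩

theorem dbl_mem_κ {a b c d : K} (h : κ s(a, b) = s(c, d)) : dbl a ∈ κ s(c, d) := by
  have ha : a ∈ κ s(c, b) := by
    rw [Sym2.eq_swap]
    exact mem_κ_rot (by rw [h]; exact Sym2.mem_mk_left _ _)
  obtain ⟨e, he⟩ := ha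
  obtain ⟨s₀, s₁, s₂, s₃, h3, -, h5, h6⟩ := κ_assoc' h he
  rw [κ_self, Sym2.eq_iff] at h3
  rcases h3 with ⟨-, rfl⟩ | ⟨rfl, rfl⟩
  · rw [h6]; exact Sym2.mem_mk_left _ _
  · have hcd : c = d := zero_mem_κ.1 (by rw [h6]; exact Sym2.mem_mk_left _ _)
    subst hcd
    rw [h5]; exact Sym2.mem_mk_left _ _

theorem κ_κ_aux {a b c d : K} (h : κ s(a, b) = s(c, d)) (hab : dbl a = dbl b)
    (hc : dbl c = zero) : κ s(c, d) = s(dbl a, dbl b) := by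
  have ha : a ∈ κ s(c, b) := by
    rw [Sym2.eq_swap]
    exact mem_κ_rot (by rw [h]; exact Sym2.mem_mk_left _ _)
  obtain ⟨e, he⟩ := ha
  obtain ⟨s₀, s₁, s₂, s₃, h3, h4, h5, h6⟩ := κ_assoc' h he
  have h00 : s₀ = zero ∧ s₂ = zero := by
    rw [κ_self, hc, Sym2.eq_iff] at h5
    tauto
  obtain ⟨rfl, rfl⟩ := h00
  have hae : a = e := zero_mem_κ.1 (by rw [h4]; exact Sym2.mem_mk_left _ _)
  subst hae
  rw [κ_self, Sym2.congr_right] at h3 h4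
  rw [h6, ← h3, ← h4, hab]

theorem κ_κ {a b c d : K} (h : κ s(a, b) = s(c, d)) : κ s(c, d) = s(dbl a, dbl b) := by
  by_cases hab : dbl a = dbl b
  · have h2 := κ_dbl _ _ _ _ h
    have hz : zero ∈ s(dbl c, dbl d) := by rw [← h2, zero_mem_κ]; exact hab
    rcases Sym2.mem_iff.1 hz with hz | hz
    · exact κ_κ_aux h hab hz.symm
    · rw [Sym2.eq_swap]
      exact κ_κ_aux (h.trans Sym2.eq_swap) hab hz.symm
  · exact (Sym2.mem_and_mem_iff hab).1
      ⟨dbl_mem_κ h, dbl_mem_κ ((congrArg κ Sym2.eq_swap).trans h)⟩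

theorem eq_iff_of_κ {a b c d : K} (h : κ s(a, b) = s(c, d)) :
    c = d ↔ dbl a = zero ∨ dbl b = zero := by
  rw [← zero_mem_κ, κ_κ h, Sym2.mem_iff, eq_comm, @eq_comm _ zero (dbl b)]

end Basic

/-! ### The 2-torsion and its action -/

section Torsion

variable (K : Type u) [KummerStructure K]

/-- The 2-torsion `K[2] = {a ∈ K | 2a = 0}`. -/
def TwoTorsion : Type u := {a : K // dbl a = zero}

variable {K}

theorem exists_act (a : K) (x : TwoTorsion K) : ∃ b, κ s(a, x.1) = s(b, b) := by
  obtain ⟨c, d, h⟩ : ∃ c d, κ s(a, x.1) = s(c, d) := by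
    induction κ s(a, x.1) with | _ c d => exact ⟨c, d, rfl⟩
  obtain rfl := (eq_iff_of_κ h).2 (Or.inr x.2)
  exact ⟨c, h⟩

/-- For `a ∈ K` and `x ∈ K[2]`, the element `a + x` of `K` with `κ {a, x} = {a + x, a + x}`. -/
noncomputable def act (a : K) (x : TwoTorsion K) : K := (exists_act a x).choose

theorem κ_act (a : K) (x : TwoTorsion K) : κ s(a, x.1) = s(act a x, act a x) :=
  (exists_act a x).choose_spec

theorem eq_act_iff {a b : K} {x : TwoTorsion K} : b = act a x ↔ b ∈ κ s(a, x.1) := by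
  rw [κ_act, Sym2.mem_iff, or_self]

theorem eq_act_of_κ {a b c : K} {x : TwoTorsion K} (h : κ s(a, x.1) = s(b, c)) :
    b = act a x := by
  rw [eq_act_iff, h]; exact Sym2.mem_mk_left _ _

theorem dbl_act (a : K) (x : TwoTorsion K) : dbl (act a x) = dbl a := by
  have h := κ_dbl _ _ _ _ (κ_act a x)
  rw [x.2, κ_zero, Sym2.eq_iff] at h
  tauto

/-- The group law on `K[2]`: `κ {x, y} = {x + y, x + y}`. -/
noncomputable instance : Add (TwoTorsion K) :=
  ⟨fun x y => ⟨act x.1 y, (dbl_act x.1 y).trans x.2⟩⟩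

instance : Zero (TwoTorsion K) := ⟨⟨zero, dbl_zero⟩⟩

theorem κ_add (x y : TwoTorsion K) : κ s(x.1, y.1) = s((x + y).1, (x + y).1) := κ_act x.1 y

theorem act_add (a : K) (x y : TwoTorsion K) : act a (x + y) = act (act a x) y := by
  have hq : κ s(y.1, x.1) = s((x + y).1, (x + y).1) := by rw [Sym2.eq_swap, κ_add]
  obtain ⟨s₀, s₁, s₂, s₃, h3, h4, h5, h6⟩ := κ_assoc' (κ_act a x) hq
  rw [Sym2.eq_swap] at h5
  exact (eq_act_of_κ h3).symm.trans (eq_act_of_κ h5)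

theorem act_zero (a : K) : act a (0 : TwoTorsion K) = a :=
  (eq_act_of_κ (κ_zero a)).symm

theorem two_torsion_add_comm (x y : TwoTorsion K) : x + y = y + x :=
  Subtype.ext (eq_act_of_κ (by rw [Sym2.eq_swap, κ_add]))

theorem two_torsion_add_self (x : TwoTorsion K) : x + x = 0 := by
  refine Subtype.ext (Eq.symm (eq_act_of_κ (c := dbl x.1) ?_))
  exact κ_self x.1

instance : Neg (TwoTorsion K) := ⟨fun x => x⟩

/-- `K[2]` is an abelian group. -/
noncomputable instance : AddCommGroup (TwoTorsion K) where
  add_assoc x y z := (Subtype.ext (act_add x.1 y z)).symm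
  zero_add x := (two_torsion_add_comm 0 x).trans (Subtype.ext (act_zero x.1))
  add_zero x := Subtype.ext (act_zero x.1)
  nsmul := nsmulRec
  zsmul := zsmulRec
  neg_add_cancel := two_torsion_add_self
  add_comm := two_torsion_add_comm

/-- `K[2]` is 2-torsion, hence a vector space over `ℤ/2`. -/
noncomputable instance : Module (ZMod 2) (TwoTorsion K) :=
  AddCommGroup.zmodModule (fun x => (two_nsmul x).trans (two_torsion_add_self x))

theorem dbl_eq_add {a b c : K} {x y : TwoTorsion K} (ha : dbl a = x.1) (hb : dbl b = y.1)
    (hc : c ∈ κ s(a, b)) : dbl c = (x + y).1 := by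
  obtain ⟨d, hd⟩ := hc
  have h := κ_dbl _ _ _ _ hd
  rw [ha, hb, κ_add, Sym2.eq_iff] at h
  rcases h with h | h
  · exact h.1.symm
  · exact h.2.symm

theorem exists_mem_κ (a b : K) : ∃ c, c ∈ κ s(a, b) := by
  induction κ s(a, b) with | _ c d => exact ⟨c, Sym2.mem_mk_left _ _⟩

variable (K) in
/-- The subgroup of those elements of `K[2]` that lie in the image `2K` of the map `2`.
When `K` is 4-torsion, `2K ⊆ K[2]`, so this subgroup is all of `2K`. -/
noncomputable def twoK : Submodule (ZMod 2) (TwoTorsion K) :=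
  AddSubgroup.toZModSubmodule 2
    { carrier := {x | ∃ a : K, dbl a = x.1}
      zero_mem' := ⟨zero, dbl_zero⟩
      add_mem' := by
        rintro x y ⟨a, ha⟩ ⟨b, hb⟩
        obtain ⟨c, hc⟩ := exists_mem_κ a b
        exact ⟨c, dbl_eq_add ha hb hc⟩
      neg_mem' := fun h => h }

/-- If `2a = 2b ∈ K[2]` then `b = a + x` for some `x ∈ K[2]`. -/
theorem exists_eq_act {a b : K} (hab : dbl a = dbl b) (ha : dbl (dbl a) = zero) :
    ∃ x : TwoTorsion K, b = act a x := by
  obtain ⟨c, d, h⟩ : ∃ c d, κ s(a, b) = s(c, d) := by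
    induction κ s(a, b) with | _ c d => exact ⟨c, d, rfl⟩
  have h2 := κ_dbl _ _ _ _ h
  rw [← hab, κ_self, ha, Sym2.eq_iff] at h2
  have hc : dbl c = zero := by
    rcases h2 with h2 | h2
    · exact h2.1.symm
    · exact h2.2.symm
  refine ⟨⟨c, hc⟩, eq_act_iff.2 (mem_κ_comm.1 ?_)⟩
  rw [h]; exact Sym2.mem_mk_left _ _

end Torsion

/-! ### The pairing `ε` and the index -/

section Index

variable (K : Type u) [KummerStructure K]

/-- A choice of representatives `e x ∈ K` with `2 (e x) = x` for all `x ∈ 2K`, and `e 0 = 0`. -/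
structure Reps where
  e : twoK K → K
  dbl_e : ∀ x, dbl (e x) = x.1.1
  e_zero : e 0 = zero

variable {K}

theorem Reps.exists_eps (r : Reps K) (x y : twoK K) :
    ∃ u : TwoTorsion K, act (r.e (x + y)) u ∈ κ s(r.e x, r.e y) := by
  obtain ⟨c, hc⟩ := exists_mem_κ (r.e x) (r.e y)
  have h : dbl (r.e (x + y)) = dbl c :=
    (r.dbl_e (x + y)).trans (dbl_eq_add (r.dbl_e x) (r.dbl_e y) hc).symm
  obtain ⟨u, rfl⟩ := exists_eq_act h (by rw [r.dbl_e]; exact (x + y).1.2)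
  exact ⟨u, hc⟩

/-- The value `ε_{x,y} ∈ K[2] / ⟨x, y⟩` of the pairing attached to a choice of representatives:
the class of those `u ∈ K[2]` with `e x + e y = ± (e (x + y) + u)`, that is, with
`e (x + y) + u` a member of the pair `κ {e x, e y}`. -/
noncomputable def Reps.eps (r : Reps K) (x y : twoK K) :
    TwoTorsion K ⧸ Submodule.span (ZMod 2) {x.1, y.1} :=
  Submodule.Quotient.mk (r.exists_eps x y).choose

theorem mem_span_pair_two {x y w : TwoTorsion K} :
    w ∈ Submodule.span (ZMod 2) {x, y} ↔ (w = 0 ∨ w = x + y) ∨ (w = x ∨ w = y) := by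
  rw [Submodule.mem_span_pair]
  constructor
  · rintro ⟨a, b, rfl⟩
    have key : ∀ a : ZMod 2, a = 0 ∨ a = 1 := by decide
    rcases key a with rfl | rfl <;> rcases key b with rfl | rfl <;> simp
  · rintro ((rfl | rfl) | (rfl | rfl))
    · exact ⟨0, 0, by simp⟩
    · exact ⟨1, 1, by simp⟩
    · exact ⟨1, 0, by simp⟩
    · exact ⟨0, 1, by simp⟩

theorem act_mem_κ_iff {a b c : K} {x y : TwoTorsion K} (ha : dbl a = x.1) (hb : dbl b = y.1)
    (hc : c ∈ κ s(a, b)) (w : TwoTorsion K) :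
    act c w ∈ κ s(a, b) ↔ w ∈ Submodule.span (ZMod 2) {x, y} := by
  have hdc := dbl_eq_add ha hb hc
  obtain ⟨d, hd⟩ := hc
  have hcd := κ_κ hd
  rw [mem_span_pair_two, hd, Sym2.mem_iff]
  refine or_congr ?_ ?_
  · rw [eq_comm, eq_act_iff, mem_κ_comm, κ_self, hdc, Sym2.mem_iff]
    exact or_congr (Subtype.ext_iff (a2 := (0 : TwoTorsion K))).symm Subtype.ext_iff.symm
  · rw [eq_comm, eq_act_iff, mem_κ_comm, hcd, ha, hb, Sym2.mem_iff]
    exact or_congr Subtype.ext_iff.symm Subtype.ext_iff.symm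

/-- `ε_{x,y}` is well defined: it is exactly the set of all admissible `u`. -/
theorem Reps.eps_eq_mk_iff (r : Reps K) (x y : twoK K) (u : TwoTorsion K) :
    r.eps x y = Submodule.Quotient.mk u ↔ act (r.e (x + y)) u ∈ κ s(r.e x, r.e y) := by
  have h := act_mem_κ_iff (r.dbl_e x) (r.dbl_e y) (r.exists_eps x y).choose_spec
    (-(r.exists_eps x y).choose + u)
  rw [← act_add, add_neg_cancel_left] at h
  rw [h, eps, eq_comm, Submodule.Quotient.eq, sub_eq_neg_add]

open Classical in
/-- The index of a (rank-3) subgroup `X ⊆ 2K`: it is `0` if representatives can be chosen such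
that `ε_V = 0` for all rank-2 subgroups `V = ⟨x, y⟩ ⊆ X`, and `1` otherwise. -/
noncomputable def indSub (X : Submodule (ZMod 2) (twoK K)) : ℕ :=
  if ∃ r : Reps K, ∀ x ∈ X, ∀ y ∈ X,
      Module.finrank (ZMod 2) (Submodule.span (ZMod 2) {x, y}) = 2 → r.eps x y = 0
  then 0 else 1

variable (K) in
open Classical in
/-- The index of `K`: the index of any rank-3 subgroup of `2K` (only meaningful if one
exists, that is, if `rank 2K ≥ 3`). -/
noncomputable def ind : ℕ :=
  if h : ∃ X : Submodule (ZMod 2) (twoK K), Module.finrank (ZMod 2) X = 3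
  then indSub h.choose else 0

end Index

end KummerStructure

namespace KummerStructure

open Submodule

/-! ### Pairings modulo spans, coboundaries, and trivialisation over one more vector -/

section Systems

variable {V : Type u} [AddCommGroup V] [Module (ZMod 2) V]

/-! Once representatives are chosen, every element of K is e_w + v with w ∈ 2K and v ∈ K[2], and v
is determined up to adding w (`Reps.act_e_eq_iff`). The structure map is then determined by the
pairing ε (`Reps.κ_act_e`): κ sends e_w + v and e_w' + v' to e_{w+w'} + v + v' + ε and its translate
by w'. So K is 2K × K[2] modulo the involution (w, v) ↦ (w, v + w), with ε measuring the failure of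
the obvious group law. If ε can be made 0, this is a twisted Kummer. If ε can be made a symmetric
bilinear S with S(x, x) = x, then S is a cocycle for an extension of 2K by K[2] whose negation is
that same involution, and K is a Kummer.

It remains to classify the possible ε. A lift of ε to K[2] satisfies identities modulo spans
(`Reps.isSystem`), and a change of representatives adds a coboundary. Three facts suffice. Any
system is trivial over a plane (`exists_trivialOn_span_pair`). Over rank 3 the only obstruction is
one bit, and it is nonzero for S, so the system or its sum with S is trivial
(`exists_trivialOn_or`). A trivialisation over a rank-3 subspace extends to the whole space by
Zorn's lemma (`exists_trivialOn`). Consequently ind_X = 0 for one rank-3 X exactly when ε vanishes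
globally for suitable representatives (`IsSplit`), a condition that does not mention X; and if ind_K
= 1, applying the extension to ε + S turns ε into S.

Conversely, a twisted Kummer splits because the norm x ↦ x + ιx is a linear surjection onto 2K and
has a linear section (`isSplit_of_twistedKummer`). A split Kummer has rank at most 2, because the
signs of lifts of three independent representatives to the group cannot be made compatible
(`rank_le_two_of_kummer`). -/

theorem zmod_two_eq (a : ZMod 2) : a = 0 ∨ a = 1 := by decide +revert

/-- Puts `ZMod 2` scalars into an identity in V, so that `match_scalars` compares coefficients in
characteristic 2. -/
theorem eq_of_one_smul {p q : V} (h : (1 : ZMod 2) • p = (1 : ZMod 2) • q) : p = q := by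
  simpa only [one_smul] using h

/-- The properties of a lift `V → V → V` of a pairing with values `ε x y ∈ V / ⟨x, y⟩` for
`x, y ∈ W` that follow from the axioms of a Kummer structure. -/
structure IsSystem (W : Submodule (ZMod 2) V) (ε : V → V → V) : Prop where
  zero : ∀ x ∈ W, ε x 0 ∈ span (ZMod 2) {x, 0}
  swap : ∀ x ∈ W, ∀ y ∈ W, ε x y + ε y x ∈ span (ZMod 2) {x, y}
  rot : ∀ x ∈ W, ∀ y ∈ W, ε x y + ε x (x + y) ∈ span (ZMod 2) {x, y}
  cocycle : ∀ x ∈ W, ∀ y ∈ W, ∀ z ∈ W,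
    ε x (y + z) + ε y z + ε (x + y) z + ε x y ∈ span (ZMod 2) {x, y, z}

/-- The pairing vanishes on `U`. -/
def IsTrivialOn (U : Submodule (ZMod 2) V) (ε : V → V → V) : Prop :=
  ∀ x ∈ U, ∀ y ∈ U, ε x y ∈ span (ZMod 2) {x, y}

/-- The pairing by which `ε` changes when the representatives are changed by `u`. -/
def cobdry (u : V → V) (x y : V) : V := u x + u y + u (x + y)

theorem mem_of_add_mem {U : Submodule (ZMod 2) V} {a b c : V} (ha : a ∈ U) (hb : b ∈ U)
    (h : c = a + b) : c ∈ U := h ▸ add_mem ha hb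

theorem add_self_eq_zero' (x : V) : x + x = 0 := ZModModule.add_self x

theorem span_pair_le {U : Submodule (ZMod 2) V} {x y : V} (hx : x ∈ U) (hy : y ∈ U) :
    span (ZMod 2) {x, y} ≤ U := by
  rw [span_le]
  rintro z (rfl | rfl)
  · exact hx
  · exact hy

theorem left_mem (x y : V) : x ∈ span (ZMod 2) {x, y} := subset_span (by simp)

theorem right_mem (x y : V) : y ∈ span (ZMod 2) {x, y} := subset_span (by simp)

theorem fst_mem (x y z : V) : x ∈ span (ZMod 2) {x, y, z} := subset_span (by simp)

theorem snd_mem (x y z : V) : y ∈ span (ZMod 2) {x, y, z} := subset_span (by simp)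

theorem trd_mem (x y z : V) : z ∈ span (ZMod 2) {x, y, z} := subset_span (by simp)

theorem span_pair_swap (x y : V) : span (ZMod 2) {x, y} = span (ZMod 2) {y, x} := by
  rw [Set.pair_comm]

theorem span_pair_rot (x y : V) : span (ZMod 2) {x, x + y} = span (ZMod 2) {x, y} := by
  apply le_antisymm
  · exact span_pair_le (left_mem _ _) (add_mem (left_mem _ _) (right_mem _ _))
  · refine span_pair_le (left_mem _ _) (mem_of_add_mem (left_mem x (x + y)) (right_mem _ _) ?_)
    apply eq_of_one_smul; match_scalars <;> grind

theorem mem_sup_singleton {U : Submodule (ZMod 2) V} {b z : V} :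
    z ∈ U ⊔ span (ZMod 2) {b} ↔ z ∈ U ∨ ∃ x ∈ U, z = b + x := by
  rw [mem_sup]
  constructor
  · rintro ⟨x, hx, w, hw, rfl⟩
    obtain ⟨a, rfl⟩ := mem_span_singleton.1 hw
    rcases zmod_two_eq a with rfl | rfl
    · left; simpa using hx
    · right; exact ⟨x, hx, by rw [one_smul, add_comm]⟩
  · rintro (h | ⟨x, hx, rfl⟩)
    · exact ⟨z, h, 0, zero_mem _, add_zero z⟩
    · exact ⟨x, hx, b, mem_span_singleton_self b, add_comm _ _⟩

theorem add_notMem {U : Submodule (ZMod 2) V} {b x : V} (hb : b ∉ U) (hx : x ∈ U) :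
    b + x ∉ U := fun h => hb ((U.add_mem_iff_left hx).1 h)

theorem add_add_cancel_two (b x : V) : b + (b + x) = x := by
  apply eq_of_one_smul; match_scalars <;> grind

namespace IsSystem

variable {W : Submodule (ZMod 2) V} {ε ε' : V → V → V}

theorem add (h : IsSystem W ε) (h' : IsSystem W ε') :
    IsSystem W (fun x y => ε x y + ε' x y) where
  zero x hx := add_mem (h.zero x hx) (h'.zero x hx)
  swap x hx y hy := mem_of_add_mem (h.swap x hx y hy) (h'.swap x hx y hy) (by abel)
  rot x hx y hy := mem_of_add_mem (h.rot x hx y hy) (h'.rot x hx y hy) (by abel)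
  cocycle x hx y hy z hz :=
    mem_of_add_mem (h.cocycle x hx y hy z hz) (h'.cocycle x hx y hy z hz) (by abel)

theorem cobdry (W : Submodule (ZMod 2) V) {u : V → V} (hu : u 0 = 0) :
    IsSystem W (cobdry u) where
  zero x _ := by
    have : KummerStructure.cobdry u x 0 = 0 := by
      simp only [KummerStructure.cobdry, hu, add_zero, add_self_eq_zero']
    rw [this]; exact zero_mem _
  swap x _ y _ := by
    have : KummerStructure.cobdry u x y + KummerStructure.cobdry u y x = 0 := by
      simp only [KummerStructure.cobdry, add_comm y x]
      apply eq_of_one_smul; match_scalars <;> grind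
    rw [this]; exact zero_mem _
  rot x _ y _ := by
    have : KummerStructure.cobdry u x y + KummerStructure.cobdry u x (x + y) = 0 := by
      simp only [KummerStructure.cobdry, add_add_cancel_two]
      apply eq_of_one_smul; match_scalars <;> grind
    rw [this]; exact zero_mem _
  cocycle x _ y _ z _ := by
    have : KummerStructure.cobdry u x (y + z) + KummerStructure.cobdry u y z +
        KummerStructure.cobdry u (x + y) z + KummerStructure.cobdry u x y = 0 := by
      simp only [KummerStructure.cobdry, add_assoc x y z]
      apply eq_of_one_smul; match_scalars <;> grind
    rw [this]; exact zero_mem _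

/-- A symmetric bilinear map with `S x x = x` is a system. -/
theorem of_bilin (W : Submodule (ZMod 2) V) (S : V →ₗ[ZMod 2] V →ₗ[ZMod 2] V)
    (hc : ∀ x y, S x y = S y x) (hs : ∀ x, S x x = x) : IsSystem W (fun x y => S x y) where
  zero x _ := by simp
  swap x _ y _ := by rw [hc y x, add_self_eq_zero']; exact zero_mem _
  rot x _ y _ := by
    rw [map_add, hs, add_left_comm, add_self_eq_zero', add_zero]; exact left_mem x y
  cocycle x _ y _ z _ := by
    have : S x (y + z) + S y z + S (x + y) z + S x y = 0 := by
      simp only [map_add, LinearMap.add_apply]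
      apply eq_of_one_smul; match_scalars <;> grind
    rw [this]; exact zero_mem _

theorem swap_mem (h : IsSystem W ε) {x y : V} (hx : x ∈ W) (hy : y ∈ W)
    (hm : ε x y ∈ span (ZMod 2) {x, y}) : ε y x ∈ span (ZMod 2) {y, x} := by
  rw [span_pair_swap]
  exact (Submodule.add_mem_iff_right _ hm).1 (h.swap x hx y hy)

theorem rot_mem (h : IsSystem W ε) {x y : V} (hx : x ∈ W) (hy : y ∈ W)
    (hm : ε x y ∈ span (ZMod 2) {x, y}) : ε x (x + y) ∈ span (ZMod 2) {x, x + y} := by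
  rw [span_pair_rot]
  exact (Submodule.add_mem_iff_right _ hm).1 (h.rot x hx y hy)

theorem rot_left (h : IsSystem W ε) {x y : V} (hx : x ∈ W) (hy : y ∈ W) :
    ε x y + ε (x + y) y ∈ span (ZMod 2) {x, y} := by
  have h1 := h.swap x hx y hy
  have h2 := h.rot y hy x hx
  have h3 := h.swap y hy (y + x) (add_mem hy hx)
  rw [span_pair_rot] at h3
  rw [span_pair_swap] at h2 h3
  refine mem_of_add_mem (add_mem h1 h2) h3 ?_
  rw [add_comm y x]
  apply eq_of_one_smul; match_scalars <;> grind

theorem zero_left (h : IsSystem W ε) {x : V} (hx : x ∈ W) : ε 0 x ∈ span (ZMod 2) {0, x} :=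
  h.swap_mem hx W.zero_mem (h.zero x hx)

theorem self (h : IsSystem W ε) {x : V} (hx : x ∈ W) : ε x x ∈ span (ZMod 2) {x, x} := by
  have := h.rot_mem hx W.zero_mem (h.zero x hx)
  rwa [add_zero] at this

/-- Pairs that do not generate a plane are covered by `zero`, `swap` and `rot`. This links the
index, which tests only rank-2 pairs, to `IsTrivialOn`. -/
theorem trivialOn_of_ne (h : IsSystem W ε) {U : Submodule (ZMod 2) V} (hU : U ≤ W)
    (hm : ∀ x ∈ U, ∀ y ∈ U, x ≠ 0 → y ≠ 0 → x ≠ y → ε x y ∈ span (ZMod 2) {x, y}) :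
    IsTrivialOn U ε := by
  intro x hx y hy
  by_cases h1 : x = 0
  · subst h1; exact h.zero_left (hU hy)
  by_cases h2 : y = 0
  · subst h2; exact h.zero x (hU hx)
  by_cases h3 : x = y
  · subst h3; exact h.self (hU hx)
  exact hm x hx y hy h1 h2 h3

theorem rot_left_mem (h : IsSystem W ε) {x y : V} (hx : x ∈ W) (hy : y ∈ W)
    (hm : ε x y ∈ span (ZMod 2) {x, y}) : ε (x + y) y ∈ span (ZMod 2) {x + y, y} := by
  rw [span_pair_swap, add_comm x y, span_pair_rot, span_pair_swap, add_comm y x]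
  exact (Submodule.add_mem_iff_right _ hm).1 (h.rot_left hx hy)

/-- A system is trivial on `U + ⟨b⟩` as soon as it is trivial on `U` and on sufficiently many
other pairs. -/
theorem trivialOn_sup (h : IsSystem W ε) {U : Submodule (ZMod 2) V} (hU : U ≤ W) {b : V}
    (hb : b ∈ W) (h0 : IsTrivialOn U ε) (h1 : ∀ x ∈ U, ε b x ∈ span (ZMod 2) {b, x})
    (h2 : ∀ x ∈ U, ∀ y ∈ U, x ≠ 0 → y ≠ 0 → x ≠ y →
      ε (b + x) y ∈ span (ZMod 2) {b + x, y}) : IsTrivialOn (U ⊔ span (ZMod 2) {b}) ε := by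
  have h3 : ∀ x ∈ U, ∀ y ∈ U, ε (b + x) y ∈ span (ZMod 2) {b + x, y} := by
    intro x hx y hy
    by_cases e1 : x = 0
    · subst e1; rw [add_zero]; exact h1 y hy
    by_cases e2 : y = 0
    · subst e2; exact h.zero _ (add_mem hb (hU hx))
    by_cases e3 : x = y
    · subst e3; exact h.rot_left_mem hb (hU hx) (h1 x hx)
    exact h2 x hx y hy e1 e2 e3
  intro p hp q hq
  rcases mem_sup_singleton.1 hp with hp | ⟨x, hx, rfl⟩ <;>
    rcases mem_sup_singleton.1 hq with hq | ⟨y, hy, rfl⟩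
  · exact h0 p hp q hq
  · exact h.swap_mem (add_mem hb (hU hy)) (hU hp) (h3 y hy p hp)
  · exact h3 x hx q hq
  -- Two vectors outside U have their sum in U, so rotation reduces this pair to one already
  -- treated.
  · have := h.rot_mem (add_mem hb (hU hx)) (hU (add_mem hx hy)) (h3 x hx _ (add_mem hx hy))
    have e : b + x + (x + y) = b + y := by apply eq_of_one_smul; match_scalars <;> grind
    rwa [e] at this

open Classical in
/-- Normalisation of the values `ε b x`. -/
theorem exists_normalized (h : IsSystem W ε) {U : Submodule (ZMod 2) V} {b : V}
    (hb : b ∈ W) (hbU : b ∉ U) : ∃ u : V → V, (∀ x ∈ U, u x = 0) ∧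
      ∀ x ∈ U, ε b x + KummerStructure.cobdry u b x ∈ span (ZMod 2) {b, x} := by
  -- Thus u (b + x) = ε b x cancels the given value, and what remains is u b = ε b 0 ∈ ⟨b⟩.
  refine ⟨fun p => if p ∈ U then 0 else ε b (b + p), fun x hx => if_pos hx, fun x hx => ?_⟩
  have hb0 := h.zero b hb
  have hle : span (ZMod 2) {b, (0 : V)} ≤ span (ZMod 2) {b, x} :=
    span_pair_le (left_mem _ _) (zero_mem _)
  simp only [KummerStructure.cobdry, if_neg hbU, if_pos hx, if_neg (add_notMem hbU hx),
    add_add_cancel_two, add_self_eq_zero']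
  refine mem_of_add_mem (hle hb0) (zero_mem _) ?_
  apply eq_of_one_smul; match_scalars <;> grind

theorem trivialOn_add_cobdry {U : Submodule (ZMod 2) V} {u : V → V} (h0 : IsTrivialOn U ε)
    (hu : ∀ x ∈ U, u x = 0) :
    IsTrivialOn U (fun x y => ε x y + KummerStructure.cobdry u x y) := by
  intro x hx y hy
  simp only [KummerStructure.cobdry, hu x hx, hu y hy, hu _ (add_mem hx hy), add_zero]
  exact h0 x hx y hy

open Classical in
/-- Extension of a trivialisation from `U` to `U + ⟨b⟩`, given the correction `t`. -/
theorem exists_trivialOn_sup_of (h : IsSystem W ε) {U : Submodule (ZMod 2) V} (hU : U ≤ W)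
    {b : V} (hb : b ∈ W) (hbU : b ∉ U) (h0 : IsTrivialOn U ε)
    (h1 : ∀ x ∈ U, ε b x ∈ span (ZMod 2) {b, x}) (t : V → ZMod 2)
    (ht : ∀ x ∈ U, ∀ y ∈ U, x ≠ 0 → y ≠ 0 → x ≠ y →
      ε (b + x) y + (t x + t (x + y)) • b ∈ span (ZMod 2) {b + x, y}) :
    ∃ u : V → V, (∀ x ∈ U, u x = 0) ∧ IsTrivialOn (U ⊔ span (ZMod 2) {b})
      (fun x y => ε x y + KummerStructure.cobdry u x y) := by
  -- The representative over b + x moves by t x • b. Being multiples of b, these changes keep ε b x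
  -- in ⟨b, x⟩.
  have hu : ∀ x ∈ U, (fun p => if p ∈ U then (0 : V) else t (b + p) • b) x = 0 :=
    fun x hx => if_pos hx
  refine ⟨_, hu, (h.add (cobdry W (hu 0 (zero_mem _)))).trivialOn_sup hU hb
    (trivialOn_add_cobdry h0 hu) (fun x hx => ?_) (fun x hx y hy hx0 hy0 hxy => ?_)⟩
  · simp only [KummerStructure.cobdry, if_pos hx, if_neg hbU, if_neg (add_notMem hbU hx)]
    exact add_mem (h1 x hx) (add_mem (add_mem (smul_mem _ _ (left_mem _ _)) (zero_mem _))
      (smul_mem _ _ (left_mem _ _)))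
  · have e : b + (b + x + y) = x + y := by apply eq_of_one_smul; match_scalars <;> grind
    simp only [KummerStructure.cobdry, if_pos hy, if_neg (add_notMem hbU hx),
      if_neg (add_notMem (add_notMem hbU hx) hy), add_add_cancel_two, e, add_zero, ← add_smul]
    exact ht x hx y hy hx0 hy0 hxy

/-- The values `ε (b + x) y` of a normalised system lie in `⟨b, x, y⟩ / ⟨b + x, y⟩ ≅ ℤ/2`. -/
theorem exists_defect (h : IsSystem W ε) {U : Submodule (ZMod 2) V} (hU : U ≤ W)
    {b : V} (hb : b ∈ W) (h0 : IsTrivialOn U ε)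
    (h1 : ∀ x ∈ U, ε b x ∈ span (ZMod 2) {b, x}) :
    ∃ d : V → V → ZMod 2, ∀ x ∈ U, ∀ y ∈ U,
      ε (b + x) y + d x y • b ∈ span (ZMod 2) {b + x, y} := by
  have : ∀ x y, ∃ d : ZMod 2, x ∈ U → y ∈ U →
      ε (b + x) y + d • b ∈ span (ZMod 2) {b + x, y} := by
    intro x y
    by_cases hxy : x ∈ U ∧ y ∈ U
    swap
    · exact ⟨0, fun hx hy => absurd ⟨hx, hy⟩ hxy⟩
    obtain ⟨hx, hy⟩ := hxy
    have hm := h.cocycle b hb x (hU hx) y (hU hy)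
    have m1 : ε b (x + y) ∈ span (ZMod 2) {b, x, y} :=
      span_pair_le (fst_mem _ _ _) (add_mem (snd_mem _ _ _) (trd_mem _ _ _)) (h1 _ (add_mem hx hy))
    have m2 : ε x y ∈ span (ZMod 2) {b, x, y} :=
      span_pair_le (snd_mem _ _ _) (trd_mem _ _ _) (h0 x hx y hy)
    have m3 : ε b x ∈ span (ZMod 2) {b, x, y} :=
      span_pair_le (fst_mem _ _ _) (snd_mem _ _ _) (h1 x hx)
    have m4 : ε (b + x) y ∈ span (ZMod 2) {b, x, y} := by
      rw [Submodule.add_mem_iff_left _ m3] at hm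
      exact (Submodule.add_mem_iff_right _ (add_mem m1 m2)).1 hm
    obtain ⟨α, β, γ, e⟩ := mem_span_triple.1 m4
    -- Modulo b + x and y, the combination αb + βx + γy equals (α + β)b.
    refine ⟨α + β, fun _ _ => ?_⟩
    refine mem_of_add_mem (smul_mem _ β (left_mem (b + x) y)) (smul_mem _ γ (right_mem _ _)) ?_
    rw [← e]
    apply eq_of_one_smul; match_scalars <;> grind
  choose d hd using this
  exact ⟨d, fun x hx y hy => hd x y hx hy⟩

end IsSystem

end Systems

/-! ### Extending trivialisations, and the obstruction in rank 3 -/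

section Extension

variable {V : Type u} [AddCommGroup V] [Module (ZMod 2) V]

theorem mem_span_pair_iff {x y w : V} :
    w ∈ span (ZMod 2) {x, y} ↔ w = 0 ∨ w = x ∨ w = y ∨ w = x + y := by
  constructor
  · intro h
    obtain ⟨a, b, rfl⟩ := mem_span_pair.1 h
    rcases zmod_two_eq a with rfl | rfl <;> rcases zmod_two_eq b with rfl | rfl <;> simp
  · rintro (rfl | rfl | rfl | rfl)
    · exact zero_mem _
    · exact left_mem _ _
    · exact right_mem _ _
    · exact add_mem (left_mem _ _) (right_mem _ _)

theorem mem_span_singleton_iff {x w : V} : w ∈ span (ZMod 2) {x} ↔ w = 0 ∨ w = x := by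
  rw [← Set.pair_eq_singleton, mem_span_pair_iff, add_self_eq_zero']
  tauto

theorem add_eq_zero_iff_eq' {x y : V} : x + y = 0 ↔ x = y := by
  rw [← ZModModule.sub_eq_add, sub_eq_zero]

/-- Modulo S + ⟨b + x⟩ the vector b agrees with x, which is not in S, and b ∉ U keeps the two apart;
so b stays nonzero. This turns membership statements into equations in ℤ/2. -/
theorem eq_zero_of_smul_mem {U S : Submodule (ZMod 2) V} {b x : V} (hb : b ∉ U) (hS : S ≤ U)
    (hxS : x ∉ S) {d : ZMod 2} (h : d • b ∈ S ⊔ span (ZMod 2) {b + x}) : d = 0 := by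
  rcases zmod_two_eq d with rfl | rfl
  · rfl
  rw [one_smul] at h
  rcases mem_sup_singleton.1 h with h | ⟨s, hs, h⟩
  · exact absurd (hS h) hb
  · rw [add_assoc, left_eq_add, add_eq_zero_iff_eq'] at h
    exact absurd (h ▸ hs) hxS

omit [Module (ZMod 2) V] in
theorem cobdry_add (u u' : V → V) (x y : V) :
    cobdry (u + u') x y = cobdry u x y + cobdry u' x y := by
  simp only [cobdry, Pi.add_apply]
  abel

theorem cobdry_eq {U : Submodule (ZMod 2) V} {u u' : V → V} (h : ∀ x ∈ U, u x = u' x) {x y : V}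
    (hx : x ∈ U) (hy : y ∈ U) : cobdry u x y = cobdry u' x y := by
  simp only [cobdry, h x hx, h y hy, h _ (add_mem hx hy)]

/-- A function on pairs with the cocycle property for triples in general position is a
coboundary, if the rank is at least 3. -/
theorem exists_potential {U : Submodule (ZMod 2) V}
    (hU : ∀ x y : V, ∃ s ∈ U, s ∉ span (ZMod 2) {x, y}) {θ : V → V → ZMod 2}
    (hθ : ∀ x ∈ U, x ≠ 0 → θ x x = 0)
    (hc : ∀ x ∈ U, ∀ x' ∈ U, ∀ x'' ∈ U, x ∉ span (ZMod 2) {x + x', x' + x''} →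
      θ x x' + θ x' x'' + θ x x'' = 0) :
    ∃ t : V → ZMod 2, ∀ x ∈ U, ∀ x' ∈ U, x ≠ 0 → x' ≠ 0 → x ≠ x' → θ x x' = t x + t x' := by
  have hsymm : ∀ x ∈ U, ∀ x' ∈ U, x ≠ 0 → x' ≠ 0 → θ x x' = θ x' x := by
    intro x hx x' hx' h0 h0'
    have := hc x hx x' hx' x hx (by
      rw [add_comm x' x, Set.pair_eq_singleton, mem_span_singleton_iff]
      simp [h0, h0'])
    rw [hθ x hx h0] at this
    grind
  have htri : ∀ x ∈ U, ∀ x' ∈ U, ∀ s ∈ U, x ≠ 0 → x' ≠ 0 → s ∉ span (ZMod 2) {x, x'} →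
      θ x x' = θ x s + θ x' s := by
    intro x hx x' hx' s hs h0 h0' hsx
    rw [mem_span_pair_iff] at hsx
    have := hc x hx x' hx' s hs (by
      rw [mem_span_pair_iff]
      rintro (e | e | e | e)
      · exact h0 e
      · exact h0' (left_eq_add.1 e)
      · exact hsx (.inr (.inr (.inr (by
          rw [e]; apply eq_of_one_smul; match_scalars <;> grind))))
      · refine hsx (.inl ?_)
        have e2 : x + x' + (x' + s) = x + s := by apply eq_of_one_smul; match_scalars <;> grind
        rw [e2] at e
        exact left_eq_add.1 e)
    grind
  obtain ⟨x₀, hx₀, hn⟩ := hU 0 0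
  have hx₀0 : x₀ ≠ 0 := by rintro rfl; exact hn (zero_mem _)
  -- The potential is θ against a base point. When x₀ lies in the plane of x and x', the triangle
  -- relation fails to apply directly, and a detour through s outside that plane replaces it; this
  -- needs rank at least 3.
  refine ⟨fun x => θ x x₀, fun x hx x' hx' h0 h0' hne => ?_⟩
  change θ x x' = θ x x₀ + θ x' x₀
  by_cases e1 : x = x₀
  · subst e1; rw [hθ x hx h0, zero_add, hsymm x hx x' hx' h0 h0']
  by_cases e2 : x' = x₀
  · subst e2; rw [hθ x' hx' h0', add_zero]
  by_cases e3 : x₀ ∈ span (ZMod 2) {x, x'}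
  · obtain ⟨s, hs, hsn⟩ := hU x x'
    rw [htri x hx x' hx' s hs h0 h0' hsn,
      htri x hx x₀ hx₀ s hs h0 hx₀0 (fun h => hsn (span_pair_le (left_mem _ _) e3 h)),
      htri x' hx' x₀ hx₀ s hs h0' hx₀0 (fun h => hsn (span_pair_le (right_mem _ _) e3 h))]
    grind
  · exact htri x hx x' hx' x₀ hx₀ h0 h0' e3

namespace IsSystem

variable {W : Submodule (ZMod 2) V} {ε : V → V → V}

/-- A trivialisation on a subspace `U` of rank at least 3 extends to `U + ⟨b⟩`. -/
theorem exists_trivialOn_sup (h : IsSystem W ε) {U : Submodule (ZMod 2) V} (hU : U ≤ W)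
    (h3 : ∀ x y : V, ∃ s ∈ U, s ∉ span (ZMod 2) {x, y})
    {b : V} (hb : b ∈ W) (hbU : b ∉ U) (h0 : IsTrivialOn U ε) :
    ∃ u : V → V, (∀ x ∈ U, u x = 0) ∧ IsTrivialOn (U ⊔ span (ZMod 2) {b})
      (fun x y => ε x y + KummerStructure.cobdry u x y) := by
  obtain ⟨u, hu, h1⟩ := h.exists_normalized hb hbU
  have h0' := trivialOn_add_cobdry h0 hu
  have h' := h.add (cobdry W (hu 0 (zero_mem _)))
  obtain ⟨d, hd⟩ := h'.exists_defect hU hb h0' h1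
  -- θ x x' is the defect of the plane through b + x and b + x', presented as (b + x, x + x'). The
  -- system cocycle at (b + x, x + x', x' + x'') makes θ a cocycle.
  obtain ⟨t, ht⟩ := exists_potential h3 (θ := fun x x' => d x (x + x')) (by
      intro x hx h0
      simp only [add_self_eq_zero']
      have m1 := hd x hx 0 (zero_mem _)
      have m2 := h'.zero (b + x) (add_mem hb (hU hx))
      rw [Submodule.add_mem_iff_right _ m2, span_pair_swap, span_insert] at m1
      refine eq_zero_of_smul_mem hbU ?_ ?_ m1
      · rw [span_zero_singleton]; exact bot_le
      · rw [span_zero_singleton]; exact h0) (by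
      intro x hx x' hx' x'' hx'' hn
      have e1 : x + x' + (x' + x'') = x + x'' := by
        apply eq_of_one_smul; match_scalars <;> grind
      have e2 : b + x + (x + x') = b + x' := by
        apply eq_of_one_smul; match_scalars <;> grind
      have m := h'.cocycle (b + x) (add_mem hb (hU hx)) (x + x') (hU (add_mem hx hx'))
        (x' + x'') (hU (add_mem hx' hx''))
      have f1 := fst_mem (b + x) (x + x') (x' + x'')
      have f2 := snd_mem (b + x) (x + x') (x' + x'')
      have f3 := trd_mem (b + x) (x + x') (x' + x'')
      have m1 := span_pair_le f1 (e1 ▸ add_mem f2 f3) (hd x hx _ (add_mem hx hx''))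
      have m2 := span_pair_le (e2 ▸ add_mem f1 f2) f3 (hd x' hx' _ (add_mem hx' hx''))
      have m3 := span_pair_le f1 f2 (hd x hx _ (add_mem hx hx'))
      have m4 := span_pair_le f2 f3 (h0' (x + x') (add_mem hx hx') _ (add_mem hx' hx''))
      have m5 := add_mem (add_mem m (add_mem m1 m2)) (add_mem m3 m4)
      simp only [e1, e2] at m5
      refine eq_zero_of_smul_mem hbU (S := span (ZMod 2) {x + x', x' + x''})
        (span_pair_le (add_mem hx hx') (add_mem hx' hx'')) hn ?_
      rw [sup_comm, ← span_insert]
      refine Set.mem_of_eq_of_mem ?_ m5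
      apply eq_of_one_smul; match_scalars <;> grind)
  obtain ⟨v, hv, hv'⟩ := h'.exists_trivialOn_sup_of hU hb hbU h0' h1 t (by
    intro x hx y hy hx0 hy0 hxy
    have := ht x hx (x + y) (add_mem hx hy) hx0 (by rwa [Ne, add_eq_zero_iff_eq'])
      (by rwa [Ne, left_eq_add])
    simp only [add_add_cancel_two] at this
    rw [← this]
    exact hd x hx y hy)
  refine ⟨u + v, fun x hx => by rw [Pi.add_apply, hu x hx, hv x hx, add_zero], ?_⟩
  simpa only [cobdry_add, add_assoc] using hv'

open Classical in
/-- A trivialisation on a subspace of rank at least 3 extends to all of `W`. -/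
theorem exists_trivialOn (h : IsSystem W ε) {U₀ : Submodule (ZMod 2) V} (hU₀ : U₀ ≤ W)
    (h3 : ∀ x y : V, ∃ s ∈ U₀, s ∉ span (ZMod 2) {x, y}) {u₀ : V → V} (hu₀ : u₀ 0 = 0)
    (h0 : IsTrivialOn U₀ (fun x y => ε x y + KummerStructure.cobdry u₀ x y)) :
    ∃ u : V → V, u 0 = 0 ∧
      IsTrivialOn W (fun x y => ε x y + KummerStructure.cobdry u x y) := by
  -- Zorn's lemma on partial trivialisations. An extension step changes u only off the current
  -- subspace, so chains agree on overlaps and can be glued.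
  let P := {p : Submodule (ZMod 2) V × (V → V) // U₀ ≤ p.1 ∧ p.1 ≤ W ∧ p.2 0 = 0 ∧
    IsTrivialOn p.1 (fun x y => ε x y + KummerStructure.cobdry p.2 x y)}
  let r : P → P → Prop := fun p q => p.1.1 ≤ q.1.1 ∧ ∀ x ∈ p.1.1, p.1.2 x = q.1.2 x
  have hr : ∀ p, r p p := fun p => ⟨le_rfl, fun _ _ => rfl⟩
  obtain ⟨m, hm⟩ := exists_maximal_of_chains_bounded (r := r) (by
    intro c hc
    rcases c.eq_empty_or_nonempty with rfl | hne
    · exact ⟨⟨(U₀, u₀), le_rfl, hU₀, hu₀, h0⟩, fun a ha => ha.elim⟩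
    have htot : ∀ p ∈ c, ∀ q ∈ c, r p q ∨ r q p := by
      intro p hp q hq
      by_cases e : p = q
      · subst e; exact Or.inl (hr p)
      · exact hc hp hq e
    have hagree : ∀ p ∈ c, ∀ q ∈ c, ∀ x ∈ p.1.1, x ∈ q.1.1 → p.1.2 x = q.1.2 x := by
      intro p hp q hq x hxp hxq
      rcases htot p hp q hq with h | h
      · exact h.2 x hxp
      · exact (h.2 x hxq).symm
    let U : Submodule (ZMod 2) V := sSup ((fun p : P => p.1.1) '' c)
    have hmem : ∀ x, x ∈ U ↔ ∃ p ∈ c, x ∈ p.1.1 := by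
      intro x
      rw [Submodule.mem_sSup_of_directed (hne.image _)]
      · simp
      · rintro _ ⟨p, hp, rfl⟩ _ ⟨q, hq, rfl⟩
        rcases htot p hp q hq with h | h
        · exact ⟨_, ⟨q, hq, rfl⟩, h.1, le_rfl⟩
        · exact ⟨_, ⟨p, hp, rfl⟩, le_rfl, h.1⟩
    let w : V → V := fun x => if hx : ∃ p ∈ c, x ∈ p.1.1 then hx.choose.1.2 x else 0
    have hw : ∀ p ∈ c, ∀ x ∈ p.1.1, p.1.2 x = w x := by
      intro p hp x hx
      have hx' : ∃ p ∈ c, x ∈ p.1.1 := ⟨p, hp, hx⟩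
      simp only [w, dif_pos hx']
      exact hagree p hp _ hx'.choose_spec.1 x hx hx'.choose_spec.2
    obtain ⟨p₀, hp₀⟩ := hne
    refine ⟨⟨(U, w), ?_, ?_, ?_, ?_⟩, fun p hp => ⟨fun x hx => (hmem x).2 ⟨p, hp, hx⟩, hw p hp⟩⟩
    · exact fun x hx => (hmem x).2 ⟨p₀, hp₀, p₀.2.1 hx⟩
    · intro x hx
      obtain ⟨p, -, hx⟩ := (hmem x).1 hx
      exact p.2.2.1 hx
    · exact (hw p₀ hp₀ 0 (zero_mem _)).symm.trans p₀.2.2.2.1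
    · intro x hx y hy
      obtain ⟨p, hp, hx⟩ := (hmem x).1 hx
      obtain ⟨q, hq, hy⟩ := (hmem y).1 hy
      have key : ∀ s ∈ c, x ∈ s.1.1 → y ∈ s.1.1 →
          ε x y + KummerStructure.cobdry w x y ∈ span (ZMod 2) {x, y} := by
        intro s hs hx hy
        rw [← cobdry_eq (hw s hs) hx hy]
        exact s.2.2.2.2 x hx y hy
      rcases htot p hp q hq with h | h
      · exact key q hq (h.1 hx) hy
      · exact key p hp hx (h.1 hy))
    (fun {p q s} hpq hqs => ⟨hpq.1.trans hqs.1,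
      fun x hx => (hpq.2 x hx).trans (hqs.2 x (hpq.1 hx))⟩)
  obtain ⟨⟨U, u⟩, hU0, hUW, hu, ht⟩ := m
  change u 0 = 0 at hu
  have hWU : W ≤ U := by
    intro b hb
    by_contra hbU
    obtain ⟨v, hv, hv'⟩ := (h.add (cobdry W hu)).exists_trivialOn_sup hUW
      (fun x y => (h3 x y).imp fun s hs => ⟨hU0 hs.1, hs.2⟩) hb hbU ht
    have hv0 := hv 0 (zero_mem _)
    have := (hm ⟨(U ⊔ span (ZMod 2) {b}, u + v), hU0.trans le_sup_left,
      sup_le hUW ((span_singleton_le_iff_mem _ _).2 hb), by simp [hu, hv0],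
      by simpa only [cobdry_add, add_assoc] using hv'⟩
      ⟨le_sup_left, fun x hx => by simp [hv x hx]⟩).1
    exact hbU (this (mem_sup_right (mem_span_singleton_self b)))
  exact ⟨u, hu, fun x hx y hy => ht x (hWU hx) y (hWU hy)⟩

theorem trivialOn_span_pair (h : IsSystem W ε) {b c : V} (hb : b ∈ W) (hc : c ∈ W)
    (hbc : ε b c ∈ span (ZMod 2) {b, c}) : IsTrivialOn (span (ZMod 2) {b, c}) ε := by
  rw [span_insert, sup_comm]
  have hcW : span (ZMod 2) {c} ≤ W := (span_singleton_le_iff_mem _ _).2 hc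
  refine h.trivialOn_sup hcW hb ?_ ?_ ?_
  · refine h.trivialOn_of_ne hcW fun x hx y hy hx0 hy0 hxy => ?_
    rw [mem_span_singleton_iff] at hx hy
    grind
  · intro x hx
    rcases mem_span_singleton_iff.1 hx with rfl | rfl
    · exact h.zero b hb
    · exact hbc
  · intro x hx y hy hx0 hy0 hxy
    rw [mem_span_singleton_iff] at hx hy
    grind

/-- Every system can be trivialised on subspaces of rank 2. -/
theorem exists_trivialOn_span_pair (h : IsSystem W ε) {b c : V} (hb : b ∈ W) (hc : c ∈ W) :
    ∃ u : V → V, u 0 = 0 ∧ IsTrivialOn (span (ZMod 2) {b, c})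
      (fun x y => ε x y + KummerStructure.cobdry u x y) := by
  by_cases hbc : b ∈ span (ZMod 2) {c}
  · refine ⟨0, rfl, (h.add (cobdry W rfl)).trivialOn_span_pair hb hc ?_⟩
    simp only [KummerStructure.cobdry, Pi.zero_apply, add_zero]
    rcases mem_span_singleton_iff.1 hbc with rfl | rfl
    · exact h.zero_left hc
    · exact h.self hc
  · obtain ⟨u, hu, hu'⟩ := h.exists_normalized hb hbc
    exact ⟨u, hu 0 (zero_mem _), (h.add (cobdry W (hu 0 (zero_mem _)))).trivialOn_span_pair hb hc
      (hu' c (mem_span_singleton_self c))⟩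

theorem trivialOn_bilin {S : V →ₗ[ZMod 2] V →ₗ[ZMod 2] V} (hS : ∀ x y, S x y = S y x)
    (hS' : ∀ x, S x x = x) {b c : V} (h : S b c = 0) :
    IsTrivialOn (span (ZMod 2) {b, c}) (fun x y => S x y) :=
  (of_bilin ⊤ S hS hS').trivialOn_span_pair mem_top mem_top (by rw [h]; exact zero_mem _)

/-- On a subspace of rank 3, a system that cannot be trivialised differs from a standard system by
a trivial one. -/
theorem exists_trivialOn_or (h : IsSystem W ε) {S : V →ₗ[ZMod 2] V →ₗ[ZMod 2] V}
    (hS : ∀ x y, S x y = S y x) (hS' : ∀ x, S x x = x) {b₁ b₂ b₃ : V} (hb₁ : b₁ ∈ W)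
    (hb₂ : b₂ ∈ W) (hb₃ : b₃ ∈ W) (hb₁0 : b₁ ≠ 0) (hb₂0 : b₂ ≠ 0) (hb₁₂ : b₁ ≠ b₂)
    (h3 : b₃ ∉ span (ZMod 2) {b₁, b₂}) (h12 : S b₁ b₂ = 0)
    (h13 : S b₃ b₁ = 0) (h23 : S b₃ b₂ = 0) :
    (∃ u : V → V, u 0 = 0 ∧ IsTrivialOn (span (ZMod 2) {b₁, b₂} ⊔ span (ZMod 2) {b₃})
      (fun x y => ε x y + KummerStructure.cobdry u x y)) ∨
    (∃ u : V → V, u 0 = 0 ∧ IsTrivialOn (span (ZMod 2) {b₁, b₂} ⊔ span (ZMod 2) {b₃})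
      (fun x y => ε x y + S x y + KummerStructure.cobdry u x y)) := by
  obtain ⟨u, hu, hu'⟩ := h.exists_trivialOn_span_pair hb₁ hb₂
  have h' := h.add (cobdry W hu)
  obtain ⟨v, hv, hv'⟩ := h'.exists_normalized hb₃ h3
  have hv0 := hv 0 (zero_mem _)
  have h0 := trivialOn_add_cobdry hu' hv
  have h'' := h'.add (cobdry W hv0)
  have hU : span (ZMod 2) {b₁, b₂} ≤ W := span_pair_le hb₁ hb₂
  obtain ⟨d, hd⟩ := h''.exists_defect hU hb₃ h0 hv'
  have m₁ := left_mem b₁ b₂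
  have m₂ := right_mem b₁ b₂
  have m₃ := add_mem m₁ m₂
  classical
  -- Three planes meet U = ⟨b₁, b₂⟩ in a line and avoid b₃ + 0. A correction t changes their defects
  -- by t x + t z, where b₃ + x and b₃ + z are the two vectors outside U. These changes sum to 0, so
  -- two defects can be killed and their total c remains. The values of t solve the first two
  -- equations with t (b₁ + b₂) = 0.
  let t : V → ZMod 2 := fun x => if x = b₁ + b₂ then 0 else if x = b₁ then d b₁ b₂ else d b₂ b₁
  have key : ∀ c : ZMod 2, c = d b₁ (b₁ + b₂) + d b₁ b₂ + d b₂ b₁ → ∃ w : V → V, w 0 = 0 ∧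
      IsTrivialOn (span (ZMod 2) {b₁, b₂} ⊔ span (ZMod 2) {b₃})
        (fun x y => ε x y + c • S x y + KummerStructure.cobdry w x y) := by
    intro c hc
    have hcS : IsSystem W (fun x y => c • S x y) := by
      rcases zmod_two_eq c with rfl | rfl
      · constructor <;> intros <;> simp
      · simpa only [one_smul] using of_bilin W S hS hS'
    have hsys := h''.add hcS
    obtain ⟨w, hw, hw'⟩ := hsys.exists_trivialOn_sup_of hU hb₃ h3
      (fun x hx y hy => add_mem (h0 x hx y hy)
        (smul_mem _ _ (trivialOn_bilin hS hS' h12 x hx y hy)))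
      (fun x hx => by
        have : S b₃ x = 0 := by
          obtain ⟨α, β, rfl⟩ := mem_span_pair.1 hx
          simp [h13, h23]
        rw [this, smul_zero, add_zero]
        exact hv' x hx) t (by
        intro x hx y hy hx0 hy0 hxy
        have e1 : b₁ + b₂ ≠ b₁ := by simpa using hb₂0
        have e2 : b₁ + b₂ ≠ b₂ := by simpa using hb₁0
        have t1 : t b₁ = d b₁ b₂ := by simp [t, hb₂0]
        have t2 : t b₂ = d b₂ b₁ := by simp [t, hb₁0, hb₁₂.symm]
        have t3 : t (b₁ + b₂) = 0 := by simp [t]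
        clear_value t
        -- The pairs (b₃ + x, y) and (b₃ + x + y, y) span the same plane; rotation settles both at
        -- once.
        have step : ∀ x ∈ span (ZMod 2) {b₁, b₂}, ∀ y ∈ span (ZMod 2) {b₁, b₂}, ∀ z,
            x + y = z → ∀ s, d x y • b₃ + (s • b₃ + c • S (b₃ + x) y) ∈
              span (ZMod 2) {b₃ + x, y} → s = t x + t z →
            (ε (b₃ + x) y + KummerStructure.cobdry u (b₃ + x) y +
              KummerStructure.cobdry v (b₃ + x) y + c • S (b₃ + x) y + (t x + t (x + y)) • b₃ ∈
              span (ZMod 2) {b₃ + x, y}) ∧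
            (ε (b₃ + z) y + KummerStructure.cobdry u (b₃ + z) y +
              KummerStructure.cobdry v (b₃ + z) y + c • S (b₃ + z) y + (t z + t (z + y)) • b₃ ∈
              span (ZMod 2) {b₃ + z, y}) := by
          rintro x hx y hy _ rfl _ hm rfl
          have hd' := hd x hx y hy
          have hr := hsys.rot_left (add_mem hb₃ (hU hx)) (hU hy)
          have e : x + y + y = x := by apply eq_of_one_smul; match_scalars <;> grind
          have f1 := mem_of_add_mem hd' hm (c := ε (b₃ + x) y +
            KummerStructure.cobdry u (b₃ + x) y +
            KummerStructure.cobdry v (b₃ + x) y + c • S (b₃ + x) y + (t x + t (x + y)) • b₃) (by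
              apply eq_of_one_smul; match_scalars <;> grind)
          refine ⟨f1, ?_⟩
          rw [e, ← add_assoc b₃, span_pair_swap, add_comm _ y, span_pair_rot, span_pair_swap,
            add_comm y]
          refine mem_of_add_mem hr f1 ?_
          apply eq_of_one_smul; match_scalars <;> grind
        have s12 := step b₁ m₁ b₂ m₂ _ rfl (d b₁ b₂) (by
          rw [map_add, LinearMap.add_apply, h23, h12, add_zero, smul_zero, add_zero,
            add_self_eq_zero']
          exact zero_mem _) (by rw [t1, t3, add_zero])
        have s21 := step b₂ m₂ b₁ m₁ _ (add_comm _ _) (d b₂ b₁) (by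
          rw [map_add, LinearMap.add_apply, h13, hS b₂, h12, add_zero, smul_zero, add_zero,
            add_self_eq_zero']
          exact zero_mem _) (by rw [t2, t3, add_zero])
        -- The only plane where S contributes: S (b₃ + b₁) (b₁ + b₂) = b₁, congruent to b₃ modulo b₃
        -- + b₁. This absorbs the leftover c.
        have s13 := step b₁ m₁ (b₁ + b₂) m₃ b₂ (add_add_cancel_two _ _) (d b₁ b₂ + d b₂ b₁) (by
          simp only [map_add, LinearMap.add_apply, h13, h23, h12, hS', add_zero, zero_add]
          refine mem_of_add_mem (smul_mem _ c (left_mem (b₃ + b₁) (b₁ + b₂))) (zero_mem _) ?_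
          rw [hc]
          apply eq_of_one_smul; match_scalars <;> grind) (by rw [t1, t2])
        rcases mem_span_pair_iff.1 hx with rfl | rfl | rfl | rfl <;>
          rcases mem_span_pair_iff.1 hy with rfl | rfl | rfl | rfl
        any_goals exact absurd rfl hx0
        any_goals exact absurd rfl hy0
        any_goals exact absurd rfl hxy
        · exact s12.1
        · exact s13.1
        · exact s21.1
        · exact s13.2
        · exact s21.2
        · exact s12.2)
    refine ⟨u + v + w, by simp [hu, hv0, hw 0 (zero_mem _)], fun x hx y hy => ?_⟩
    refine Set.mem_of_eq_of_mem ?_ (hw' x hx y hy)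
    simp only [cobdry_add]
    abel
  rcases zmod_two_eq (d b₁ (b₁ + b₂) + d b₁ b₂ + d b₂ b₁) with e | e
  · left
    simpa only [zero_smul, add_zero] using key 0 e.symm
  · right
    simpa only [one_smul] using key 1 e.symm

end IsSystem

end Extension

/-! ### Independent triples, rank, and the standard bilinear map -/

section Rank

variable {V : Type u} [AddCommGroup V] [Module (ZMod 2) V]

theorem linearIndependent_triple {b₁ b₂ b₃ : V} (hb₁ : b₁ ≠ 0) (hb₂ : b₂ ≠ 0) (hb₁₂ : b₁ ≠ b₂)
    (h3 : b₃ ∉ span (ZMod 2) {b₁, b₂}) : LinearIndependent (ZMod 2) ![b₁, b₂, b₃] := by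
  rw [Fintype.linearIndependent_iff]
  intro g hg
  rw [mem_span_pair_iff] at h3
  push Not at h3
  obtain ⟨h0, h1, h2, h12⟩ := h3
  simp only [Fin.sum_univ_three, Matrix.cons_val] at hg
  have key : g 0 = 0 ∧ g 1 = 0 ∧ g 2 = 0 := by
    rcases zmod_two_eq (g 0) with e0 | e0 <;> rcases zmod_two_eq (g 1) with e1 | e1 <;>
      rcases zmod_two_eq (g 2) with e2 | e2 <;>
      simp only [e0, e1, e2, zero_smul, one_smul, add_zero, zero_add] at hg ⊢ <;>
      simp_all [add_eq_zero_iff_eq', eq_comm]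
  intro i
  fin_cases i
  · exact key.1
  · exact key.2.1
  · exact key.2.2

theorem finrank_triple {b₁ b₂ b₃ : V} (hb₁ : b₁ ≠ 0) (hb₂ : b₂ ≠ 0) (hb₁₂ : b₁ ≠ b₂)
    (h3 : b₃ ∉ span (ZMod 2) {b₁, b₂}) :
    Module.finrank (ZMod 2) ↥(span (ZMod 2) {b₁, b₂} ⊔ span (ZMod 2) {b₃}) = 3 := by
  have h := finrank_span_eq_card (linearIndependent_triple hb₁ hb₂ hb₁₂ h3)
  rw [Fintype.card_fin] at h
  have e : ({b₁, b₂} ∪ {b₃} : Set V) = Set.range ![b₁, b₂, b₃] := by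
    ext x
    simp [eq_comm (a := x)]
    tauto
  rw [← span_union, e]
  exact h

theorem exists_notMem_span_pair {U : Submodule (ZMod 2) V}
    (hU : Module.finrank (ZMod 2) U = 3) (x y : V) : ∃ s ∈ U, s ∉ span (ZMod 2) {x, y} := by
  classical
  by_contra! h
  have h1 : U ≤ span (ZMod 2) (({x, y} : Finset V) : Set V) := by
    rwa [Finset.coe_pair]
  have h2 := Submodule.finrank_mono h1
  have h3 := finrank_span_finset_le_card (R := ZMod 2) ({x, y} : Finset V)
  have h4 := Finset.card_le_two (a := x) (b := y)
  rw [Set.finrank] at h3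
  omega

theorem finrank_span_pair {x y : V} (hx : x ≠ 0) (hy : y ≠ 0) (hxy : x ≠ y) :
    Module.finrank (ZMod 2) (span (ZMod 2) {x, y}) = 2 := by
  have hli : LinearIndependent (ZMod 2) ![x, y] := by
    rw [LinearIndependent.pair_iff]
    intro s t h
    rcases zmod_two_eq s with rfl | rfl <;> rcases zmod_two_eq t with rfl | rfl <;>
      simp_all [add_eq_zero_iff_eq']
  have h := finrank_span_eq_card hli
  rw [Fintype.card_fin] at h
  have e : ({x, y} : Set V) = Set.range ![x, y] := by
    ext z
    simp [eq_comm (a := z), or_comm]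
  rw [e]
  exact h

theorem le_span_pair_or (W : Submodule (ZMod 2) V) :
    (∃ b ∈ W, ∃ c ∈ W, W ≤ span (ZMod 2) {b, c}) ∨
    ∃ b₁ ∈ W, ∃ b₂ ∈ W, ∃ b₃ ∈ W, b₁ ≠ 0 ∧ b₂ ≠ 0 ∧ b₁ ≠ b₂ ∧
      b₃ ∉ span (ZMod 2) {b₁, b₂} := by
  by_contra! h
  obtain ⟨h1, h2⟩ := h
  obtain ⟨b₁, hb₁, hn⟩ := SetLike.not_le_iff_exists.1 (h1 0 W.zero_mem 0 W.zero_mem)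
  obtain ⟨b₂, hb₂, hn'⟩ := SetLike.not_le_iff_exists.1 (h1 b₁ hb₁ b₁ hb₁)
  obtain ⟨b₃, hb₃, hn''⟩ := SetLike.not_le_iff_exists.1 (h1 b₁ hb₁ b₂ hb₂)
  refine hn'' (h2 b₁ hb₁ b₂ hb₂ b₃ hb₃ ?_ ?_ ?_)
  · rintro rfl; exact hn (zero_mem _)
  · rintro rfl; exact hn' (zero_mem _)
  · rintro rfl; exact hn' (left_mem _ _)

theorem rank_le_two_iff {W : Submodule (ZMod 2) V} :
    Module.rank (ZMod 2) W ≤ 2 ↔ ∃ b ∈ W, ∃ c ∈ W, W ≤ span (ZMod 2) {b, c} := by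
  constructor
  · intro h
    refine (le_span_pair_or W).resolve_right ?_
    rintro ⟨b₁, hb₁, b₂, hb₂, b₃, hb₃, n₁, n₂, n₁₂, n₃⟩
    have hle : span (ZMod 2) {b₁, b₂} ⊔ span (ZMod 2) {b₃} ≤ W :=
      sup_le (span_pair_le hb₁ hb₂) ((span_singleton_le_iff_mem _ _).2 hb₃)
    have h1 := (Submodule.rank_mono hle).trans h
    have h2 := Module.finrank_le_of_rank_le (n := 2) (by exact_mod_cast h1)
    rw [finrank_triple n₁ n₂ n₁₂ n₃] at h2
    omega
  · rintro ⟨b, -, c, -, h⟩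
    refine (Submodule.rank_mono h).trans ((rank_span_le _).trans ?_)
    exact (Cardinal.mk_insert_le).trans (by rw [Cardinal.mk_singleton]; norm_num)

/-- S is the coordinatewise product in the basis. Coordinates in ℤ/2 are idempotent, which gives S x
x = x; formally, x ↦ S x x is additive by symmetry and fixes the basis. -/
theorem exists_bilin_of_basis {ι : Type*} (B : Module.Basis ι (ZMod 2) V) :
    ∃ S : V →ₗ[ZMod 2] V →ₗ[ZMod 2] V, (∀ x y, S x y = S y x) ∧ (∀ x, S x x = x) ∧
      ∀ i j, i ≠ j → S (B i) (B j) = 0 := by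
  classical
  let S : V →ₗ[ZMod 2] V →ₗ[ZMod 2] V :=
    B.constr (ZMod 2) fun i => B.constr (ZMod 2) fun j => if i = j then B i else 0
  have hSB : ∀ i j, S (B i) (B j) = if i = j then B i else 0 := by
    intro i j
    simp only [S, Module.Basis.constr_basis]
  have hsymm : ∀ x y, S x y = S y x := by
    have : S = S.flip := by
      refine B.ext fun i => B.ext fun j => ?_
      rw [LinearMap.flip_apply, hSB, hSB]
      by_cases h : i = j
      · subst h; rfl
      · rw [if_neg h, if_neg (Ne.symm h)]
    intro x y
    exact congrArg (fun T : V →ₗ[ZMod 2] V →ₗ[ZMod 2] V => T x y) this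
  have hself : ∀ x, S x x = x := by
    let q : V →+ V :=
      { toFun := fun x => S x x
        map_zero' := by simp
        map_add' := fun x y => by
          simp only [map_add, LinearMap.add_apply]
          rw [hsymm y x]
          apply eq_of_one_smul; match_scalars <;> grind }
    have : q.toZModLinearMap 2 = LinearMap.id := by
      refine B.ext fun i => ?_
      change S (B i) (B i) = B i
      rw [hSB, if_pos rfl]
    exact fun x => congrArg (fun T : V →ₗ[ZMod 2] V => T x) this
  exact ⟨S, hsymm, hself, fun i j hij => by rw [hSB, if_neg hij]⟩

/-- There is a symmetric bilinear map `S` with `S x x = x` for which three given independent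
vectors are orthogonal. -/
theorem exists_bilin {b₁ b₂ b₃ : V} (hli : LinearIndependent (ZMod 2) ![b₁, b₂, b₃]) :
    ∃ S : V →ₗ[ZMod 2] V →ₗ[ZMod 2] V, (∀ x y, S x y = S y x) ∧ (∀ x, S x x = x) ∧
      S b₁ b₂ = 0 ∧ S b₃ b₁ = 0 ∧ S b₃ b₂ = 0 := by
  have hs := hli.linearIndepOn_id
  obtain ⟨S, h1, h2, h3⟩ := exists_bilin_of_basis (Module.Basis.extend hs)
  have h0 : ∀ i j : Fin 3, i ≠ j → S (![b₁, b₂, b₃] i) (![b₁, b₂, b₃] j) = 0 := by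
    intro i j hij
    have := h3 ⟨_, hs.subset_extend _ ⟨i, rfl⟩⟩ ⟨_, hs.subset_extend _ ⟨j, rfl⟩⟩
      (fun h => hij (hli.injective (congrArg Subtype.val h)))
    rwa [Module.Basis.extend_apply_self, Module.Basis.extend_apply_self] at this
  exact ⟨S, h1, h2, h0 0 1 (by decide), h0 2 0 (by decide), h0 2 1 (by decide)⟩

end Rank

/-! ### From Kummer structures to systems; the index -/

section Representatives

variable {K : Type u} [KummerStructure K]

/-- The associativity diagram for u, a, b has one entry that lies both in κ{u, c}, hence is c + u,
and in κ{b, a + u}. -/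
theorem act_mem_κ_act_left {a b c : K} (h : c ∈ κ s(a, b)) (u : TwoTorsion K) :
    act c u ∈ κ s(act a u, b) := by
  obtain ⟨d, hd⟩ := h
  obtain ⟨s₀, s₁, s₂, s₃, h3, h4, h5, h6⟩ := κ_assoc' (a := u.1) (b := a) (c := b)
    (p₀ := act a u) (p₁ := act a u) (q₀ := c) (q₁ := d)
    (by rw [Sym2.eq_swap]; exact κ_act a u) (by rw [Sym2.eq_swap]; exact hd)
  rw [Sym2.eq_swap] at h3
  rw [Sym2.eq_swap, ← eq_act_of_κ h3, h5]
  exact Sym2.mem_mk_left _ _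

theorem act_mem_κ_act {a b c : K} (h : c ∈ κ s(a, b)) (u v : TwoTorsion K) :
    act c (u + v) ∈ κ s(act a u, act b v) := by
  rw [act_add]
  have h1 := act_mem_κ_act_left h u
  rw [Sym2.eq_swap] at h1
  have h2 := act_mem_κ_act_left h1 v
  rwa [Sym2.eq_swap] at h2

theorem nonempty_reps : Nonempty (Reps K) := by
  classical
  have h : ∀ x : twoK K, ∃ a : K, dbl a = x.1.1 := fun x => x.2
  choose f hf using h
  refine ⟨⟨fun x => if x = 0 then zero else f x, fun x => ?_, if_pos rfl⟩⟩
  by_cases hx : x = 0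
  · subst hx
    rw [if_pos rfl]
    exact dbl_zero
  · rw [if_neg hx]; exact hf x

namespace Reps

open Classical in
/-- A lift of the pairing `ε` to a function on `K[2]`. -/
noncomputable def lift (r : Reps K) (x y : TwoTorsion K) : TwoTorsion K :=
  if h : x ∈ twoK K ∧ y ∈ twoK K then (r.exists_eps ⟨x, h.1⟩ ⟨y, h.2⟩).choose else 0

theorem act_lift_mem (r : Reps K) (x y : twoK K) :
    act (r.e (x + y)) (r.lift x.1 y.1) ∈ κ s(r.e x, r.e y) := by
  rw [lift, dif_pos ⟨x.2, y.2⟩]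
  exact (r.exists_eps x y).choose_spec

theorem act_mem_iff (r : Reps K) (x y : twoK K) (v : TwoTorsion K) :
    act (r.e (x + y)) v ∈ κ s(r.e x, r.e y) ↔
      v + r.lift x.1 y.1 ∈ span (ZMod 2) {x.1, y.1} := by
  rw [← act_mem_κ_iff (r.dbl_e x) (r.dbl_e y) (r.act_lift_mem x y), ← act_add, add_left_comm,
    two_torsion_add_self, add_zero]

theorem act_lift_mem_of_eq (r : Reps K) {x y z : twoK K} (h : x + y = z) :
    act (r.e z) (r.lift x.1 y.1) ∈ κ s(r.e x, r.e y) := h ▸ r.act_lift_mem x y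

theorem act_mem_iff_of_eq (r : Reps K) {x y z : twoK K} (h : x + y = z) (v : TwoTorsion K) :
    act (r.e z) v ∈ κ s(r.e x, r.e y) ↔
      v + r.lift x.1 y.1 ∈ span (ZMod 2) {x.1, y.1} := h ▸ r.act_mem_iff x y v

theorem isSystem_swap (r : Reps K) (x) (hx : x ∈ twoK K) (y) (hy : y ∈ twoK K) :
    r.lift x y + r.lift y x ∈ span (ZMod 2) {x, y} := by
  have := (r.act_mem_iff_of_eq (x := ⟨x, hx⟩) (y := ⟨y, hy⟩) (add_comm _ _) (r.lift y x)).1 (by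
    rw [Sym2.eq_swap]; exact r.act_lift_mem ⟨y, hy⟩ ⟨x, hx⟩)
  rwa [add_comm] at this

theorem isSystem (r : Reps K) : IsSystem (twoK K) r.lift where
  zero x hx := by
    have := (r.act_mem_iff_of_eq (add_zero (⟨x, hx⟩ : twoK K)) 0).1 (by
      rw [act_zero, r.e_zero, κ_zero]; exact Sym2.mem_mk_left _ _)
    rwa [zero_add] at this
  swap := r.isSystem_swap
  rot x hx y hy := by
    have h1 := r.act_lift_mem ⟨x, hx⟩ ⟨y, hy⟩
    -- The relation c ∈ κ{a, b} is symmetric in a, b, c; exchanging b and c gives `rot` after a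
    -- shift by ε.
    rw [mem_κ_comm] at h1
    have h2 := act_mem_κ_act h1 0 (r.lift x y)
    rw [act_zero, zero_add, ← act_add, two_torsion_add_self, act_zero] at h2
    have h3 := (r.act_mem_iff_of_eq (x := ⟨x, hx⟩) (y := ⟨x, hx⟩ + ⟨y, hy⟩)
      (add_add_cancel_two _ _) _).1 h2
    rw [← span_pair_rot]
    exact h3
  cocycle x hx y hy z hz := by
    let X : twoK K := ⟨x, hx⟩
    let Y : twoK K := ⟨y, hy⟩
    let Z : twoK K := ⟨z, hz⟩
    have hp := r.act_lift_mem X Y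
    have hq := r.act_lift_mem_of_eq (add_comm Z Y)
    obtain ⟨p₁, hp⟩ := hp
    obtain ⟨q₁, hq⟩ := hq
    obtain ⟨s₀, s₁, s₂, s₃, h3, h4, h5, h6⟩ := κ_assoc' hp hq
    -- The entry s₀ is reached by both bracketings of e_X, e_Y, e_Z. Writing it as e_{X+Y+Z} + w and
    -- computing w both ways gives the cocycle relation.
    have m1 : s₀ ∈ κ s(r.e X, act (r.e (Y + Z)) (r.lift Z.1 Y.1)) := by
      rw [h3]; exact Sym2.mem_mk_left _ _
    have m2 : s₀ ∈ κ s(r.e Z, act (r.e (X + Y)) (r.lift X.1 Y.1)) := by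
      rw [h5]; exact Sym2.mem_mk_left _ _
    have hd : dbl (r.e (X + (Y + Z))) = dbl s₀ := by
      rw [r.dbl_e, dbl_eq_add (r.dbl_e X) ((dbl_act _ _).trans (r.dbl_e (Y + Z))) m1]
      rfl
    obtain ⟨w, rfl⟩ := exists_eq_act hd (by rw [r.dbl_e]; exact (X + (Y + Z)).1.2)
    have n1 := act_mem_κ_act m1 0 (r.lift Z.1 Y.1)
    rw [act_zero, zero_add, ← act_add, ← act_add, two_torsion_add_self, act_zero,
      r.act_mem_iff] at n1
    have n2 := act_mem_κ_act m2 0 (r.lift X.1 Y.1)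
    rw [act_zero, zero_add, ← act_add, ← act_add, two_torsion_add_self, act_zero,
      r.act_mem_iff_of_eq (by abel)] at n2
    have f1 := fst_mem x y z
    have f2 := snd_mem x y z
    have f3 := trd_mem x y z
    have m3 := span_pair_le f1 (add_mem f2 f3) n1
    have m4 := span_pair_le f3 (add_mem f1 f2) n2
    have m5 := span_pair_le f2 f3 (r.isSystem_swap y hy z hz)
    have m6 := span_pair_le f3 (add_mem f1 f2)
      (r.isSystem_swap z hz (x + y) (add_mem hx hy))
    refine mem_of_add_mem (add_mem m3 m4) (add_mem m5 m6) ?_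
    change _ = w + r.lift z y + r.lift x (y + z) + (w + r.lift x y + r.lift z (x + y)) + _
    apply eq_of_one_smul; match_scalars <;> grind

/-- New representatives obtained from a modification by `u`. -/
theorem exists_reps_of_trivialOn (r : Reps K) {u : TwoTorsion K → TwoTorsion K} (hu : u 0 = 0)
    (S : TwoTorsion K → TwoTorsion K → TwoTorsion K)
    (h : IsTrivialOn (twoK K) (fun x y => r.lift x y + S x y + cobdry u x y)) :
    ∃ r' : Reps K, ∀ x y : twoK K, act (r'.e (x + y)) (S x.1 y.1) ∈ κ s(r'.e x, r'.e y) := by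
  refine ⟨⟨fun x => act (r.e x) (u x.1), fun x => (dbl_act _ _).trans (r.dbl_e x), ?_⟩,
    fun x y => ?_⟩
  · change act (r.e 0) (u 0) = zero
    rw [hu, act_zero, r.e_zero]
  · have h1 := h x.1 x.2 y.1 y.2
    have h2 : act (r.e (x + y)) (u x.1 + u y.1 + u (x + y).1 + S x.1 y.1) ∈
        κ s(act (r.e x) 0, act (r.e y) 0) := by
      rw [act_zero, act_zero, r.act_mem_iff]
      refine Set.mem_of_eq_of_mem ?_ h1
      change u x.1 + u y.1 + u (x.1 + y.1) + S x.1 y.1 + r.lift x.1 y.1 =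
        r.lift x.1 y.1 + S x.1 y.1 + (u x.1 + u y.1 + u (x.1 + y.1))
      abel
    have h3 := act_mem_κ_act h2 (u x.1) (u y.1)
    simp only [act_zero, ← act_add] at h3 ⊢
    convert h3 using 2
    apply eq_of_one_smul; match_scalars <;> grind

theorem trivialOn_of_eps (r : Reps K) {X : Submodule (ZMod 2) (twoK K)}
    (h : ∀ x ∈ X, ∀ y ∈ X,
      Module.finrank (ZMod 2) (span (ZMod 2) {x, y}) = 2 → r.eps x y = 0) :
    IsTrivialOn (X.map (twoK K).subtype) r.lift := by
  refine r.isSystem.trivialOn_of_ne (map_subtype_le _ _) ?_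
  rintro _ ⟨x, hx, rfl⟩ _ ⟨y, hy, rfl⟩ hx0 hy0 hxy
  have h1 := h x hx y hy (finrank_span_pair (by rintro rfl; exact hx0 rfl)
    (by rintro rfl; exact hy0 rfl) (by rintro rfl; exact hxy rfl))
  have h2 := (r.act_mem_iff x y 0).1 ((r.eps_eq_mk_iff x y 0).1 h1)
  rwa [zero_add] at h2

end Reps

variable (K) in
/-- Representatives can be chosen with `ε = 0` everywhere. -/
def IsSplit : Prop := ∃ r : Reps K, ∀ x y : twoK K, r.e (x + y) ∈ κ s(r.e x, r.e y)

theorem isSplit_of_trivialOn {r : Reps K} {u : TwoTorsion K → TwoTorsion K} (hu : u 0 = 0)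
    (h : IsTrivialOn (twoK K) (fun x y => r.lift x y + cobdry u x y)) : IsSplit K := by
  obtain ⟨r', hr'⟩ := r.exists_reps_of_trivialOn hu (fun _ _ => 0) (by simpa only [add_zero] using h)
  exact ⟨r', fun x y => by simpa only [act_zero] using hr' x y⟩

theorem IsSplit.indSub_eq_zero (h : IsSplit K) (X : Submodule (ZMod 2) (twoK K)) :
    indSub X = 0 := by
  obtain ⟨r, hr⟩ := h
  refine if_pos ⟨r, fun x _ y _ _ => (r.eps_eq_mk_iff x y 0).2 ?_⟩
  rw [act_zero]
  exact hr x y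

theorem isSplit_of_indSub_eq_zero {X : Submodule (ZMod 2) (twoK K)}
    (hX : Module.finrank (ZMod 2) X = 3) (h : indSub X = 0) : IsSplit K := by
  have h' : ∃ r : Reps K, ∀ x ∈ X, ∀ y ∈ X,
      Module.finrank (ZMod 2) (Submodule.span (ZMod 2) {x, y}) = 2 → r.eps x y = 0 := by
    by_contra hn
    rw [indSub, if_neg hn] at h
    exact one_ne_zero h
  obtain ⟨r, hr⟩ := h'
  have h0 := r.trivialOn_of_eps hr
  obtain ⟨u, hu, hu'⟩ := r.isSystem.exists_trivialOn (map_subtype_le _ X)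
    (exists_notMem_span_pair (by rwa [finrank_map_subtype_eq])) (u₀ := 0) rfl (by
      simpa only [cobdry, Pi.zero_apply, add_zero] using h0)
  exact isSplit_of_trivialOn hu hu'

/-- A trivialisation over X extends to all of 2K. The right-hand side does not involve X, whence the
index is independent of X. -/
theorem indSub_eq_zero_iff {X : Submodule (ZMod 2) (twoK K)}
    (hX : Module.finrank (ZMod 2) X = 3) : indSub X = 0 ↔ IsSplit K :=
  ⟨isSplit_of_indSub_eq_zero hX, fun h => h.indSub_eq_zero X⟩

theorem indSub_eq_zero_or_one (X : Submodule (ZMod 2) (twoK K)) :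
    indSub X = 0 ∨ indSub X = 1 := by
  rw [indSub]
  split_ifs
  · exact Or.inl rfl
  · exact Or.inr rfl

theorem exists_ind_eq (h : ∃ X : Submodule (ZMod 2) (twoK K), Module.finrank (ZMod 2) X = 3) :
    ∃ X : Submodule (ZMod 2) (twoK K), Module.finrank (ZMod 2) X = 3 ∧ ind K = indSub X :=
  ⟨h.choose, h.choose_spec, dif_pos h⟩

theorem indSub_eq_ind {X : Submodule (ZMod 2) (twoK K)}
    (hX : Module.finrank (ZMod 2) X = 3) : indSub X = ind K := by
  obtain ⟨Y, hY, h⟩ := exists_ind_eq ⟨X, hX⟩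
  rw [h]
  have h1 := (indSub_eq_zero_iff hX).trans (indSub_eq_zero_iff hY).symm
  rcases indSub_eq_zero_or_one X with hx | hx <;> rcases indSub_eq_zero_or_one Y with hy | hy <;>
    simp_all

theorem exists_finrank_eq_three (h : ¬ Module.rank (ZMod 2) (twoK K) ≤ 2) :
    ∃ X : Submodule (ZMod 2) (twoK K), Module.finrank (ZMod 2) X = 3 := by
  rw [rank_le_two_iff] at h
  obtain ⟨b₁, hb₁, b₂, hb₂, b₃, hb₃, n₁, n₂, n₁₂, n₃⟩ := (le_span_pair_or _).resolve_left h
  have hle : span (ZMod 2) {b₁, b₂} ⊔ span (ZMod 2) {b₃} ≤ twoK K :=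
    sup_le (span_pair_le hb₁ hb₂) ((span_singleton_le_iff_mem _ _).2 hb₃)
  exact ⟨_, (comapSubtypeEquivOfLe hle).finrank_eq.trans (finrank_triple n₁ n₂ n₁₂ n₃)⟩

theorem isSplit_iff : IsSplit K ↔ Module.rank (ZMod 2) (twoK K) ≤ 2 ∨ ind K = 0 := by
  by_cases h : Module.rank (ZMod 2) (twoK K) ≤ 2
  · simp only [h, true_or, iff_true]
    obtain ⟨b, hb, c, hc, hle⟩ := rank_le_two_iff.1 h
    obtain ⟨r⟩ := nonempty_reps (K := K)
    obtain ⟨u, hu, hu'⟩ := r.isSystem.exists_trivialOn_span_pair hb hc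
    exact isSplit_of_trivialOn hu fun x hx y hy => hu' x (hle hx) y (hle hy)
  · obtain ⟨X, hX⟩ := exists_finrank_eq_three h
    rw [← indSub_eq_ind hX, indSub_eq_zero_iff hX]
    simp [h]

/-- If `rank 2K ≤ 2` or the index is `1`, then `ε` is given by a symmetric bilinear map. -/
theorem exists_reps_bilin (h : Module.rank (ZMod 2) (twoK K) ≤ 2 ∨ ind K = 1) :
    ∃ S : TwoTorsion K →ₗ[ZMod 2] TwoTorsion K →ₗ[ZMod 2] TwoTorsion K,
      (∀ x y, S x y = S y x) ∧ (∀ x, S x x = x) ∧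
      ∃ r : Reps K, ∀ x y : twoK K, act (r.e (x + y)) (S x.1 y.1) ∈ κ s(r.e x, r.e y) := by
  obtain ⟨r⟩ := nonempty_reps (K := K)
  by_cases h2 : Module.rank (ZMod 2) (twoK K) ≤ 2
  · obtain ⟨b, hb, c, hc, hle⟩ := rank_le_two_iff.1 h2
    obtain ⟨S, hS, hS', -⟩ :=
      exists_bilin_of_basis (Module.Basis.ofVectorSpace (ZMod 2) (TwoTorsion K))
    obtain ⟨u, hu, hu'⟩ :=
      (r.isSystem.add (IsSystem.of_bilin _ S hS hS')).exists_trivialOn_span_pair hb hc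
    exact ⟨S, hS, hS', r.exists_reps_of_trivialOn hu (fun x y => S x y)
      fun x hx y hy => hu' x (hle hx) y (hle hy)⟩
  · have hns : ¬ IsSplit K := by
      rw [isSplit_iff]
      simp [h2, h.resolve_left h2]
    rw [rank_le_two_iff] at h2
    obtain ⟨b₁, hb₁, b₂, hb₂, b₃, hb₃, n₁, n₂, n₁₂, n₃⟩ := (le_span_pair_or _).resolve_left h2
    obtain ⟨S, hS, hS', h12, h13, h23⟩ := exists_bilin (linearIndependent_triple n₁ n₂ n₁₂ n₃)
    have hle : span (ZMod 2) {b₁, b₂} ⊔ span (ZMod 2) {b₃} ≤ twoK K :=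
      sup_le (span_pair_le hb₁ hb₂) ((span_singleton_le_iff_mem _ _).2 hb₃)
    have h3 := exists_notMem_span_pair (finrank_triple n₁ n₂ n₁₂ n₃)
    refine ⟨S, hS, hS', ?_⟩
    rcases r.isSystem.exists_trivialOn_or hS hS' hb₁ hb₂ hb₃ n₁ n₂ n₁₂ n₃ h12 h13 h23 with
      ⟨u, hu, hu'⟩ | ⟨u, hu, hu'⟩
    -- If ε itself were trivial over this rank-3 subspace it would be so globally, contradicting
    -- index 1. Hence ε + S is trivial there, and its trivialisation extends in the same way.
    · obtain ⟨v, hv, hv'⟩ := r.isSystem.exists_trivialOn hle h3 hu hu'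
      exact absurd (isSplit_of_trivialOn hv hv') hns
    · obtain ⟨v, hv, hv'⟩ := (r.isSystem.add (IsSystem.of_bilin _ S hS hS')).exists_trivialOn
        hle h3 hu hu'
      exact r.exists_reps_of_trivialOn hv (fun x y => S x y) hv'

end Representatives

/-! ### Parametrisations by groups, and the twisted case -/

section Isomorphisms

variable {K : Type u} [KummerStructure K] {G : Type u} [AddCommGroup G]

theorem val_inj {x y : TwoTorsion K} : x.1 = y.1 ↔ x = y := Subtype.ext_iff.symm

/-- With its converse `exists_map_of_equiv`, this replaces isomorphisms to a quotient of G by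
surjections G → K whose fibres are the ι-orbits. -/
theorem exists_equiv_of_map {ι : G ≃+ G} {hι : ∀ x, ι (ι x) = x} {π : G → K}
    (hs : Function.Surjective π) (he : ∀ x y, π x = π y ↔ y = x ∨ y = ι x)
    (hκ : ∀ x y, κ s(π x, π y) = s(π (x + y), π (x + ι y))) :
    ∃ f : K ≃ InvQuot ι hι, ∀ p : Sym2 K,
      Sym2.map f (κ p) = InvQuot.kap ι hι (Sym2.map f p) := by
  let g : InvQuot ι hι → K := Quotient.lift π fun x y h => (he x y).2 h
  have hg : ∀ x, g (InvQuot.mk ι hι x) = π x := fun _ => rfl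
  have hb : Function.Bijective g := by
    constructor
    · rintro ⟨x⟩ ⟨y⟩ h
      exact InvQuot.mk_eq_iff.2 ((he x y).1 h)
    · intro a
      obtain ⟨x, rfl⟩ := hs a
      exact ⟨InvQuot.mk ι hι x, rfl⟩
  let f := (Equiv.ofBijective g hb).symm
  have hf : ∀ x, f (π x) = InvQuot.mk ι hι x := fun x =>
    (Equiv.ofBijective g hb).symm_apply_apply (InvQuot.mk ι hι x)
  refine ⟨f, fun p => ?_⟩
  induction p with | _ a b
  obtain ⟨x, rfl⟩ := hs a
  obtain ⟨y, rfl⟩ := hs b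
  rw [hκ, Sym2.map_mk, Sym2.map_mk, hf, hf, hf, hf, InvQuot.kap_mk]

theorem exists_map_of_equiv {ι : G ≃+ G} {hι : ∀ x, ι (ι x) = x} (f : K ≃ InvQuot ι hι)
    (hf : ∀ p : Sym2 K, Sym2.map f (κ p) = InvQuot.kap ι hι (Sym2.map f p)) :
    ∃ π : G → K, Function.Surjective π ∧ (∀ x y, π x = π y ↔ y = x ∨ y = ι x) ∧
      ∀ x y, κ s(π x, π y) = s(π (x + y), π (x + ι y)) := by
  refine ⟨fun x => f.symm (InvQuot.mk ι hι x), fun a => ?_, fun x y => ?_, fun x y => ?_⟩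
  · obtain ⟨x, hx⟩ := Quotient.exists_rep (f a)
    refine ⟨x, ?_⟩
    change f.symm (Quotient.mk _ x) = a
    rw [hx, f.symm_apply_apply]
  · rw [f.symm.injective.eq_iff, InvQuot.mk_eq_iff]
  · apply Sym2.map.injective f.injective
    simp only [hf, Sym2.map_mk, f.apply_symm_apply, InvQuot.kap_mk]

theorem map_zero_eq {ι : G ≃+ G} {π : G → K}
    (hκ : ∀ x y, κ s(π x, π y) = s(π (x + y), π (x + ι y))) : π 0 = zero := by
  have h : (zero : K) ∈ κ s(π 0, π 0) := zero_mem_κ.2 rfl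
  rw [hκ, map_zero, add_zero, Sym2.mem_iff, or_self] at h
  exact h.symm

theorem exists_map_iff_kummer : (∃ (G : Type u) (_ : AddCommGroup G), Nonempty (Iso K (Kummer G))) ↔
    ∃ (G : Type u) (_ : AddCommGroup G) (π : G → K), Function.Surjective π ∧
      (∀ x y, π x = π y ↔ y = x ∨ y = -x) ∧
      ∀ x y, κ s(π x, π y) = s(π (x + y), π (x + -y)) := by
  constructor
  · rintro ⟨G, _, ⟨f⟩⟩
    exact ⟨G, _, exists_map_of_equiv f.toEquiv f.map_κ⟩
  · rintro ⟨G, _, π, hs, he, hκ⟩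
    obtain ⟨f, hf⟩ := exists_equiv_of_map (ι := AddEquiv.neg G) (hι := fun x => neg_neg x) hs he hκ
    exact ⟨G, _, ⟨⟨f, hf⟩⟩⟩

theorem exists_map_iff_twistedKummer :
    (∃ (G : Type u) (_ : AddCommGroup G) (T : TwistedGroup G),
      Nonempty (Iso K (TwistedKummer T))) ↔
    ∃ (G : Type u) (_ : AddCommGroup G) (T : TwistedGroup G) (π : G → K), Function.Surjective π ∧
      (∀ x y, π x = π y ↔ y = x ∨ y = T.ι x) ∧
      ∀ x y, κ s(π x, π y) = s(π (x + y), π (x + T.ι y)) := by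
  constructor
  · rintro ⟨G, _, T, ⟨f⟩⟩
    exact ⟨G, _, T, exists_map_of_equiv f.toEquiv f.map_κ⟩
  · rintro ⟨G, _, T, π, hs, he, hκ⟩
    obtain ⟨f, hf⟩ := exists_equiv_of_map (ι := T.ι) (hι := T.ι_ι) hs he hκ
    exact ⟨G, _, T, ⟨⟨f, hf⟩⟩⟩

namespace Reps

variable (r : Reps K)

theorem exists_eq_act_e (h4 : ∀ a : K, dbl (dbl a) = zero) (a : K) :
    ∃ (w : twoK K) (v : TwoTorsion K), act (r.e w) v = a := by
  let w : twoK K := ⟨⟨dbl a, h4 a⟩, ⟨a, rfl⟩⟩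
  obtain ⟨v, hv⟩ := exists_eq_act (a := r.e w) (b := a) (r.dbl_e w) (by rw [r.dbl_e]; exact h4 a)
  exact ⟨w, v, hv.symm⟩

/-- The stabiliser of a under K[2] is read off from κ{a, a} = {0, 2a}: it consists of 0 and 2a. -/
theorem act_e_eq_iff {w w' : twoK K} {v v' : TwoTorsion K} :
    act (r.e w) v = act (r.e w') v' ↔ w' = w ∧ (v' = v ∨ v' = v + w.1) := by
  have key : ∀ (w : twoK K) (v v' : TwoTorsion K),
      act (r.e w) v = act (r.e w) v' ↔ (v' = v ∨ v' = v + w.1) := by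
    intro w v v'
    have h1 : act (r.e w) v = act (r.e w) v' ↔ r.e w = act (r.e w) (v + v') := by
      constructor
      · intro h
        rw [act_add, h, ← act_add, two_torsion_add_self, act_zero]
      · intro h
        conv_lhs => rw [h]
        rw [← act_add, add_right_comm, two_torsion_add_self, zero_add]
    rw [h1, eq_act_iff, mem_κ_comm, κ_self, r.dbl_e, Sym2.mem_iff]
    refine or_congr ((val_inj (y := 0)).trans ?_) (val_inj.trans ?_)
    · rw [add_eq_zero_iff_eq', eq_comm]
    · rw [← add_eq_zero_iff_eq', ← add_eq_zero_iff_eq' (x := v')]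
      rw [show v + v' + w.1 = v' + (v + w.1) by abel]
  constructor
  · intro h
    have hw : w' = w := by
      have := congrArg dbl h
      rw [dbl_act, dbl_act, r.dbl_e, r.dbl_e] at this
      exact Subtype.ext (Subtype.ext this.symm)
    subst hw
    exact ⟨rfl, (key _ _ _).1 h⟩
  · rintro ⟨rfl, h⟩
    exact (key _ _ _).2 h

theorem κ_act_e {w w' : twoK K} {s : TwoTorsion K} (hs : act (r.e (w + w')) s ∈ κ s(r.e w, r.e w'))
    (v v' : TwoTorsion K) : κ s(act (r.e w) v, act (r.e w') v') =
      s(act (r.e (w + w')) (v + v' + s), act (r.e (w + w')) (v + v' + s + w'.1)) := by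
  have h1 := act_mem_κ_act hs v v'
  rw [← act_add, add_comm s] at h1
  have hd : dbl (act (r.e w) v) = w.1.1 := (dbl_act _ _).trans (r.dbl_e w)
  have hd' : dbl (act (r.e w') v') = w'.1.1 := (dbl_act _ _).trans (r.dbl_e w')
  have h2 := (act_mem_κ_iff hd hd' h1 w'.1).2 (right_mem _ _)
  rw [← act_add] at h2
  obtain ⟨d, hd1⟩ := h1
  -- Two distinct members determine the unordered pair. If they coincide, w or w' is 0, and then κ
  -- gives a repeated element.
  by_cases he : act (r.e (w + w')) (v + v' + s) = act (r.e (w + w')) (v + v' + s + w'.1)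
  · have hz : dbl (act (r.e w) v) = zero ∨ dbl (act (r.e w') v') = zero := by
      rw [hd, hd']
      rcases (r.act_e_eq_iff.1 he).2 with h | h
      · exact Or.inr (val_inj.2 (add_eq_left.1 h))
      · have h' : w'.1 = w.1 + w'.1 := add_left_cancel h
        exact Or.inl (val_inj.2 (right_eq_add.1 h'))
    rw [← he, hd1, ← (eq_iff_of_κ hd1).2 hz]
  · exact (Sym2.mem_and_mem_iff he).1 ⟨⟨d, hd1⟩, h2⟩

end Reps

/-- With ε = 0 the group is the product 2K × K[2], and ι (w, v) = (w, v + w). -/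
theorem exists_twistedKummer (h4 : ∀ a : K, dbl (dbl a) = zero) (h : IsSplit K) :
    ∃ (G : Type u) (_ : AddCommGroup G) (T : TwistedGroup G),
      Nonempty (Iso K (TwistedKummer T)) := by
  obtain ⟨r, hr⟩ := h
  let ι : twoK K × TwoTorsion K →+ twoK K × TwoTorsion K :=
    { toFun := fun x => (x.1, x.2 + x.1.1)
      map_zero' := by simp
      map_add' := fun x y => by
        refine Prod.ext rfl ?_
        change x.2 + y.2 + (x.1.1 + y.1.1) = x.2 + x.1.1 + (y.2 + y.1.1)
        abel }
  have hι : ∀ x, ι (ι x) = x := fun x => by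
    refine Prod.ext rfl ?_
    change x.2 + x.1.1 + x.1.1 = x.2
    rw [add_assoc, two_torsion_add_self, add_zero]
  let T : TwistedGroup (twoK K × TwoTorsion K) :=
    { two_torsion := fun x => Prod.ext (Subtype.ext (two_torsion_add_self _))
        (two_torsion_add_self _)
      ι := { ι with invFun := ι, left_inv := hι, right_inv := hι }
      ι_ι := hι }
  refine exists_map_iff_twistedKummer.2 ⟨_, _, T, fun x => act (r.e x.1) x.2, fun a => ?_,
    fun x y => ?_, fun x y => ?_⟩
  · obtain ⟨w, v, h⟩ := r.exists_eq_act_e h4 a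
    exact ⟨(w, v), h⟩
  · refine r.act_e_eq_iff.trans ?_
    rw [and_or_left, Prod.ext_iff, Prod.ext_iff]
    rfl
  · refine (r.κ_act_e (s := 0) (by rw [act_zero]; exact hr _ _) x.2 y.2).trans ?_
    rw [add_zero, add_assoc]
    rfl

/-- As 2G = 0, the norm N : x ↦ x + ιx is a ℤ/2-linear surjection onto 2K. The images in K of a
linear section are representatives with ε = 0. -/
theorem isSplit_of_twistedKummer (h4 : ∀ a : K, dbl (dbl a) = zero)
    (h : ∃ (G : Type u) (_ : AddCommGroup G) (T : TwistedGroup G),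
      Nonempty (Iso K (TwistedKummer T))) : IsSplit K := by
  obtain ⟨G, _, T, π, hs, he, hκ⟩ := exists_map_iff_twistedKummer.1 h
  have hπ0 := map_zero_eq hκ
  have hdbl : ∀ x, π (x + T.ι x) = dbl (π x) := by
    intro x
    have := hκ x x
    rw [T.two_torsion, hπ0, κ_self, Sym2.congr_right] at this
    exact this.symm
  let _ : Module (ZMod 2) G := AddCommGroup.zmodModule fun x => (two_nsmul x).trans (T.two_torsion x)
  let N : G →+ twoK K :=
    { toFun := fun x => ⟨⟨π (x + T.ι x), by rw [hdbl]; exact h4 _⟩, ⟨π x, (hdbl x).symm⟩⟩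
      map_zero' := by
        refine Subtype.ext (Subtype.ext ?_)
        change π (0 + T.ι 0) = zero
        rw [map_zero, add_zero, hπ0]
      map_add' := fun x y => by
        refine Subtype.ext (Subtype.ext ?_)
        refine eq_act_iff.2 ?_
        change π (x + y + T.ι (x + y)) ∈ κ s(π (x + T.ι x), π (y + T.ι y))
        rw [hκ, add_add_add_comm x (T.ι x) y, ← map_add]
        exact Sym2.mem_mk_left _ _ }
  have hN : Function.Surjective (N.toZModLinearMap 2) := by
    rintro ⟨⟨w, hw⟩, ⟨a, ha⟩⟩
    obtain ⟨x, rfl⟩ := hs a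
    exact ⟨x, Subtype.ext (Subtype.ext ((hdbl x).trans ha))⟩
  obtain ⟨σ, hσ⟩ := LinearMap.exists_rightInverse_of_surjective _ (LinearMap.range_eq_top.2 hN)
  refine ⟨⟨fun w => π (σ w), fun w => ?_, ?_⟩, fun x y => ?_⟩
  · rw [← hdbl]
    exact congrArg (fun z : twoK K => z.1.1) (LinearMap.congr_fun hσ w)
  · rw [map_zero, hπ0]
  · change π (σ (x + y)) ∈ κ s(π (σ x), π (σ y))
    rw [map_add, hκ]
    exact Sym2.mem_mk_left _ _

end Isomorphisms

/-! ### Kummers of abelian groups -/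

section KummerGroup

variable {V : Type u} [AddCommGroup V] [Module (ZMod 2) V]

/-- The set underlying the extension of `W` by `V` attached to a bilinear map on `V`. -/
structure BilinExt (W : Submodule (ZMod 2) V) (S : V →ₗ[ZMod 2] V →ₗ[ZMod 2] V) : Type u where
  /-- the component in the quotient `W` -/
  fst : W
  /-- the component in the subgroup `V` -/
  snd : V

namespace BilinExt

variable {W : Submodule (ZMod 2) V} {S : V →ₗ[ZMod 2] V →ₗ[ZMod 2] V}

theorem ext' {x y : BilinExt W S} (h1 : x.fst = y.fst) (h2 : x.snd = y.snd) : x = y := by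
  cases x; cases y; cases h1; cases h2; rfl

instance : Add (BilinExt W S) :=
  ⟨fun x y => ⟨x.fst + y.fst, x.snd + y.snd + S x.fst y.fst⟩⟩

instance : Zero (BilinExt W S) := ⟨⟨0, 0⟩⟩

instance : Neg (BilinExt W S) := ⟨fun x => ⟨x.fst, x.snd + S x.fst x.fst⟩⟩

theorem fst_add (x y : BilinExt W S) : (x + y).fst = x.fst + y.fst := rfl

theorem snd_add (x y : BilinExt W S) : (x + y).snd = x.snd + y.snd + S x.fst y.fst := rfl

theorem fst_zero : (0 : BilinExt W S).fst = 0 := rfl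

theorem snd_zero : (0 : BilinExt W S).snd = 0 := rfl

theorem fst_neg (x : BilinExt W S) : (-x).fst = x.fst := rfl

theorem snd_neg (x : BilinExt W S) : (-x).snd = x.snd + S x.fst x.fst := rfl

/-- The group law defined by the cocycle `S`. -/
@[reducible]
def addCommGroup (W : Submodule (ZMod 2) V) (hS : ∀ x y, S x y = S y x) :
    AddCommGroup (BilinExt W S) where
  add_assoc x y z := ext' (add_assoc _ _ _) (by
    simp only [fst_add, snd_add, Submodule.coe_add, map_add, LinearMap.add_apply]
    abel)
  zero_add x := ext' (zero_add _) (by simp [snd_add, fst_zero, snd_zero])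
  add_zero x := ext' (add_zero _) (by simp [snd_add, fst_zero, snd_zero])
  nsmul := nsmulRec
  zsmul := zsmulRec
  neg_add_cancel x := ext' (add_self_eq_zero' _) (by
    simp only [snd_add, fst_neg, snd_neg, snd_zero]
    apply eq_of_one_smul; match_scalars <;> grind)
  add_comm x y := ext' (add_comm _ _) (by
    rw [snd_add, snd_add, hS, add_comm x.snd])

end BilinExt

variable {K : Type u} [KummerStructure K]

theorem exists_kummer (h4 : ∀ a : K, dbl (dbl a) = zero)
    {S : TwoTorsion K →ₗ[ZMod 2] TwoTorsion K →ₗ[ZMod 2] TwoTorsion K}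
    (hS : ∀ x y, S x y = S y x) (hS' : ∀ x, S x x = x) {r : Reps K}
    (hr : ∀ x y : twoK K, act (r.e (x + y)) (S x.1 y.1) ∈ κ s(r.e x, r.e y)) :
    ∃ (G : Type u) (_ : AddCommGroup G), Nonempty (Iso K (Kummer G)) := by
  -- S w w = w makes negation the involution (w, v) ↦ (w, v + w).
  have hneg : ∀ x : BilinExt (twoK K) S, -x = ⟨x.fst, x.snd + x.fst.1⟩ := fun x =>
    BilinExt.ext' rfl (by rw [BilinExt.snd_neg, hS'])
  refine exists_map_iff_kummer.2 ⟨_, BilinExt.addCommGroup (twoK K) hS,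
    fun x => act (r.e x.fst) x.snd, fun a => ?_, fun x y => ?_, fun x y => ?_⟩
  · obtain ⟨w, v, h⟩ := r.exists_eq_act_e h4 a
    exact ⟨⟨w, v⟩, h⟩
  · refine r.act_e_eq_iff.trans ?_
    change _ ↔ y = x ∨ y = -x
    rw [hneg]
    obtain ⟨a, b⟩ := x
    obtain ⟨c, d⟩ := y
    simp only [BilinExt.mk.injEq, and_or_left]
  · refine (r.κ_act_e (hr _ _) x.snd y.snd).trans ?_
    change _ = s(act (r.e (x + y).fst) (x + y).snd, act (r.e (x + -y).fst) (x + -y).snd)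
    simp only [BilinExt.fst_add, BilinExt.snd_add, hneg]
    rw [← add_assoc x.snd, add_right_comm (x.snd + y.snd)]

/-- Were b₁, b₂, b₃ ∈ 2K independent, lifts a, b, c of split representatives would have to satisfy
sign conditions for all their sums. Every coincidence of signs forces the double of a, b, c or a sum
of them to vanish, against independence. -/
theorem rank_le_two_of_kummer (hs : IsSplit K) (h4 : ∀ a : K, dbl (dbl a) = zero)
    (h : ∃ (G : Type u) (_ : AddCommGroup G), Nonempty (Iso K (Kummer G))) :
    Module.rank (ZMod 2) (twoK K) ≤ 2 := by
  obtain ⟨G, _, π, hsurj, he, hκ⟩ := exists_map_iff_kummer.1 h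
  have hπ0 : π 0 = zero := map_zero_eq (ι := AddEquiv.neg G) hκ
  have hdbl : ∀ x, dbl (π x) = π (x + x) := by
    intro x
    have := hκ x x
    rw [add_neg_cancel, hπ0, κ_self, Sym2.eq_swap, Sym2.congr_left] at this
    exact this
  have hadd : ∀ x y, π (x + y) ∈ κ s(π x, π y) := fun x y => by
    rw [hκ]; exact Sym2.mem_mk_left _ _
  have hne : ∀ (x : G) (v : TwoTorsion K), dbl (π x) = v.1 → v ≠ 0 → x + x ≠ 0 := by
    intro x v hv h0 hx
    rw [hdbl, hx, hπ0] at hv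
    exact h0 (val_inj.1 hv.symm)
  rw [rank_le_two_iff]
  refine (le_span_pair_or _).resolve_right ?_
  rintro ⟨b₁, hb₁, b₂, hb₂, b₃, hb₃, n₁, n₂, n₁₂, n₃⟩
  obtain ⟨r, hr⟩ := hs
  let B₁ : twoK K := ⟨b₁, hb₁⟩
  let B₂ : twoK K := ⟨b₂, hb₂⟩
  let B₃ : twoK K := ⟨b₃, hb₃⟩
  rw [mem_span_pair_iff] at n₃
  push Not at n₃
  obtain ⟨m0, m1, m2, m12⟩ := n₃
  obtain ⟨a, ha⟩ := hsurj (r.e B₁)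
  -- Replacing b by -b leaves π b unchanged, so e_{B₁+B} may be taken to be the image of a + b
  -- rather than of a - b.
  have hlift : ∀ B : twoK K, ∃ b, π b = r.e B ∧ π (a + b) = r.e (B₁ + B) := by
    intro B
    obtain ⟨b, hb⟩ := hsurj (r.e B)
    have := hr B₁ B
    rw [← ha, ← hb, hκ, Sym2.mem_iff] at this
    rcases this with h | h
    · exact ⟨b, hb, h.symm⟩
    · exact ⟨-b, by rw [← hb, he]; exact Or.inr (neg_neg b).symm, h.symm⟩
  obtain ⟨b, hb, hab⟩ := hlift B₂
  obtain ⟨c, hc, hac⟩ := hlift B₃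
  have da : dbl (π a) = b₁.1 := by rw [ha, r.dbl_e]
  have db : dbl (π b) = b₂.1 := by rw [hb, r.dbl_e]
  have dc : dbl (π c) = b₃.1 := by rw [hc, r.dbl_e]
  have dab := dbl_eq_add da db (hadd a b)
  have dac := dbl_eq_add da dc (hadd a c)
  have dbc := dbl_eq_add db dc (hadd b c)
  have dabc := dbl_eq_add da dbc (hadd a (b + c))
  have na := hne _ _ da n₁
  have nb := hne _ _ db n₂
  have nc := hne _ _ dc m0
  have nab := hne _ _ dab (by rwa [Ne, add_eq_zero_iff_eq'])
  have nac := hne _ _ dac (by rwa [Ne, add_eq_zero_iff_eq', eq_comm])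
  have nbc := hne _ _ dbc (by rwa [Ne, add_eq_zero_iff_eq', eq_comm])
  have nabc := hne _ _ dabc (by rwa [Ne, ← add_assoc, add_eq_zero_iff_eq', eq_comm])
  -- Converts 2(b - c) = 0 into 2(b + c) = 0, which is excluded.
  have hc4 : c + c + (c + c) = 0 := by
    have h1 := h4 (π c)
    rw [hdbl, hdbl, ← hπ0, he] at h1
    rcases h1 with h1 | h1
    · exact h1.symm
    · exact neg_eq_zero.1 h1.symm
  have h23 := hr B₂ B₃
  have h23' := hr (B₁ + B₂) (B₁ + B₃)
  have e23 : B₁ + B₂ + (B₁ + B₃) = B₂ + B₃ := by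
    apply eq_of_one_smul; match_scalars <;> grind
  rw [← hb, ← hc, hκ, Sym2.mem_iff] at h23
  rw [e23, ← hab, ← hac, hκ, Sym2.mem_iff] at h23'
  -- Besides ±(b ± c), the sum (a + b) + (a + c) allows only ±(2a + b + c) or ±(b - c); the common
  -- choice is ±(b - c).
  have h23'' : r.e (B₂ + B₃) = π (b + -c) := by
    rcases h23 with h | h
    · rw [h] at h23'
      exfalso
      rcases h23' with h' | h' <;> rcases (he _ _).1 h' with h' | h'
      · exact na (by linear_combination (norm := module) h')
      · exact nabc (by linear_combination (norm := module) h')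
      · exact nc (by linear_combination (norm := module) -h')
      · exact nb (by linear_combination (norm := module) h')
    · exact h
  -- e_{B₁+B₂+B₃} is computed from three decompositions. The candidate a + (b - c) conflicts with
  -- the second, and a - (b - c) with the third.
  have k1 := hr B₁ (B₂ + B₃)
  have k2 := hr B₂ (B₁ + B₃)
  have k3 := hr B₃ (B₁ + B₂)
  rw [h23'', ← ha, hκ, Sym2.mem_iff] at k1
  rw [show B₂ + (B₁ + B₃) = B₁ + (B₂ + B₃) by abel, ← hac, ← hb, hκ, Sym2.mem_iff] at k2
  rw [show B₃ + (B₁ + B₂) = B₁ + (B₂ + B₃) by abel, ← hab, ← hc, hκ, Sym2.mem_iff] at k3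
  rcases k1 with k1 | k1
  · rw [k1] at k2
    rcases k2 with k | k <;> rcases (he _ _).1 k with k | k
    · exact nc (by linear_combination (norm := module) k)
    · exact nab (by linear_combination (norm := module) k)
    · exact na (by linear_combination (norm := module) -k)
    · exact nbc (by linear_combination (norm := module) k + hc4)
  · rw [k1] at k3
    rcases k3 with k | k <;> rcases (he _ _).1 k with k | k
    · exact nb (by linear_combination (norm := module) k)
    · exact nac (by linear_combination (norm := module) k)
    · exact na (by linear_combination (norm := module) -k)
    · exact nbc (by linear_combination (norm := module) hc4 - k)

end KummerGroup

end KummerStructure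

open KummerStructure in
theorem mainTheorem3 (K : Type u) [KummerStructure K]
    (h4 : ∀ a : K, dbl (dbl a) = zero)
    (h2 : ∃ a : K, dbl a ≠ zero) :
    (∀ X : Submodule (ZMod 2) (twoK K), Module.finrank (ZMod 2) X = 3 → indSub X = ind K) ∧
    ((∃ (G : Type u) (_ : AddCommGroup G), Nonempty (Iso K (Kummer G))) ↔
      (Module.rank (ZMod 2) (twoK K) ≤ 2 ∨ ind K = 1)) ∧
    ((∃ (G : Type u) (_ : AddCommGroup G) (T : TwistedGroup G),
        Nonempty (Iso K (TwistedKummer T))) ↔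
      (Module.rank (ZMod 2) (twoK K) ≤ 2 ∨ ind K = 0)) := by
  refine ⟨fun X hX => indSub_eq_ind hX, ⟨fun h => ?_, fun h => ?_⟩, ?_⟩
  · by_cases hr : Module.rank (ZMod 2) (twoK K) ≤ 2
    · exact Or.inl hr
    · obtain ⟨X, hX⟩ := exists_finrank_eq_three hr
      rw [← indSub_eq_ind hX]
      refine Or.inr ((indSub_eq_zero_or_one X).resolve_left fun h0 => hr ?_)
      exact rank_le_two_of_kummer ((indSub_eq_zero_iff hX).1 h0) h4 h
  · obtain ⟨S, hS, hS', r, hr⟩ := exists_reps_bilin h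
    exact exists_kummer h4 hS hS' hr
  · rw [← isSplit_iff]
    exact ⟨isSplit_of_twistedKummer h4, exists_twistedKummer h4⟩
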